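/- For $\pi\in S_n$ let $d(\pi)=\#\{1\le i\le n-1:\pi(i)>\pi(i+1)\}$ be its number of descents. For a partition $\lambda$ of $n\ge 1$, let $\mathcal C_\lambda\subset S_n$ be the conjugacy class of permutations whose cycle lengths (fixed points included) are the parts of $\lambda$, let $m_1(\lambda)$ be the number of parts of $\lambda$ equal to $1$ (the number of fixed points of each element of $\mathcal C_\lambda$), and let $\pi$ be uniformly distributed on $\mathcal C_\lambda$. Define the random variable $W_\lambda$ by $$d(\pi)=\frac{n+1}{2}-\frac{m_1(\lambda)^2}{2n}+\sqrt n\,W_\lambda .$$ Let $(n_k)_{k\ge 0}$ be a sequence of positive integers with $n_k\to\infty$, let $\lambda^{(k)}$ be a partition of $n_k$ for each $k$, and suppose that $m_1(\lambda^{(k)})/n_k\to\alpha\in\mathbb R$ as $k\to\infty$. Then $W_{\lambda^{(k)}}$ converges in distribution, as $k\to\infty$, to the normal distribution $$\mathcal N\!\left(0,\ \frac{1-4\alpha^3+3\alpha^4}{12}\right),$$ understood as the point mass at $0$ when the variance is $0$ (that is, when $\alpha=1$). -/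

import Mathlib

/-- The descent set of `π ∈ S_n`: the positions `i` such that `i + 1` is also a position and
`π(i) > π(i + 1)`. Positions and values are numbered from `0`. -/
def descentSet {n : ℕ} (π : Equiv.Perm (Fin n)) : Finset (Fin n) :=
  {i : Fin n | ∃ h : (i : ℕ) + 1 < n, π ⟨(i : ℕ) + 1, h⟩ < π i}

/-- The descent number `d(π)`. -/
def descentNumber {n : ℕ} (π : Equiv.Perm (Fin n)) : ℕ :=
  (descentSet π).card

/-- The conjugacy class `C_p` of `S_n`: the permutations whose multiset of cycle lengths
(fixed points counted as cycles of length `1`) is the partition `p` of `n`. -/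
def cycleClass {n : ℕ} (p : n.Partition) : Set (Equiv.Perm (Fin n)) :=
  {π | π.partition.parts = p.parts}

/-- The number `m₁` of parts of `p` equal to `1`, i.e. of fixed points of each element
of `C_p`. -/
def numFixed {n : ℕ} (p : n.Partition) : ℕ :=
  p.parts.count 1

theorem cycleClass_nonempty {n : ℕ} (p : n.Partition) : (cycleClass p).Nonempty := by
  have hdec : p.parts.filter (2 ≤ ·) + Multiset.replicate (p.parts.count 1) 1 = p.parts := by
    have h1 : p.parts.filter (fun i => ¬ 2 ≤ i) = Multiset.replicate (p.parts.count 1) 1 := by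
      rw [← Multiset.filter_eq']
      refine Multiset.filter_congr fun x hx => ?_
      have := p.parts_pos hx
      omega
    rw [← h1, Multiset.filter_add_not]
  have hsum : (p.parts.filter (2 ≤ ·)).sum + p.parts.count 1 = n := by
    have h2 := congrArg Multiset.sum hdec
    simpa [p.parts_sum] using h2
  obtain ⟨g, hg⟩ := (Equiv.Perm.exists_with_cycleType_iff (Fin n)
    (m := p.parts.filter (2 ≤ ·))).2
      ⟨by rw [Fintype.card_fin]; omega, fun a ha => (Multiset.mem_filter.1 ha).2⟩
  refine ⟨g, ?_⟩
  have hs : g.support.card = (p.parts.filter (2 ≤ ·)).sum := by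
    rw [← hg, Equiv.Perm.sum_cycleType]
  have hc : Fintype.card (Fin n) - g.support.card = p.parts.count 1 := by
    rw [hs, Fintype.card_fin]; omega
  change g.partition.parts = p.parts
  rw [Equiv.Perm.parts_partition, hg, hc, hdec]

instance instMeasurableSpacePermFin (n : ℕ) : MeasurableSpace (Equiv.Perm (Fin n)) := ⊤

instance instDiscreteMeasurableSpacePermFin (n : ℕ) :
    DiscreteMeasurableSpace (Equiv.Perm (Fin n)) := ⟨fun _ => trivial⟩

/-- The law of a uniformly random element of the conjugacy class `C_p`. -/
noncomputable def uniformClass {n : ℕ} (p : n.Partition) :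
    MeasureTheory.Measure (Equiv.Perm (Fin n)) :=
  ProbabilityTheory.uniformOn (cycleClass p)

instance instIsProbabilityMeasureUniformClass {n : ℕ} (p : n.Partition) :
    MeasureTheory.IsProbabilityMeasure (uniformClass p) :=
  ProbabilityTheory.isProbabilityMeasure_uniformOn (Set.toFinite _) (cycleClass_nonempty p)

/-- The normalized descent number `W_p`, the solution of
`d(π) = (n + 1) / 2 - m₁ ^ 2 / (2 n) + √n * W_p(π)` (for `n ≥ 1`). -/
noncomputable def normDescents {n : ℕ} (p : n.Partition) (π : Equiv.Perm (Fin n)) : ℝ :=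
  ((descentNumber π : ℝ) - (((n : ℝ) + 1) / 2 - (numFixed p : ℝ) ^ 2 / (2 * (n : ℝ))))
    / Real.sqrt (n : ℝ)

/-! Everything rests on an exact identity of Gessel–Reutenauer type. Weakly increasing words over
`a` letters that rise strictly at the descents of `π` number `(a + n - 1 - d(π)).choose n`. Summing
over all conjugates of a fixed `τ` therefore counts pairs (colouring, total order) compatible with
`τ` (`IsAdmissible`). The same pairs can be counted by inserting the cycles of `τ` one at a time: a
new cycle of length `l` spells a primitive word, and among the points already present with that word
it may take any slot. This gives one factor, "primitive words of length `l` plus earlier points of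
period `l`", per cycle (`card_admissiblePair_sumMap`). Both sides are polynomials in `a`, so the
identity holds at every complex `z` (`integral_prod_eq_eval_necklacePoly`).

Put `z = 1/u` and multiply by `u ^ n`. The left side becomes the mean of `∏ (1 + (k - d) u)`. On the
right the fixed points give `∏_{j < m₁} (1 + j u)`, and all longer cycles together give a factor
tending to `1` when `n u → 0`. Expand both logarithms to second order, with `D = (n - 1)/2 - d` and
`u = i s/(n b)` (`exists_integral_exp_scaled`).

For `b = √n` the left side is close to the mean of `exp(i s D/√n + (s²/2)((D/n)² + 1/12))`. This is
almost a characteristic function, up to the random term `(D/n)²`. The coarser scale `b = n` gives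
`D/n → α²/2` in `L¹` (`tendsto_integral_abs_centredAscents_div_sub`), so that term may be replaced
by `α⁴/4`. The fixed points contribute the centring and `(s²/2) α³/3`, and the exponent becomes
`-(s²/2)(1 - 4α³ + 3α⁴)/12` (`tendsto_integral_exp_standardized`). Lévy's continuity theorem
finishes. -/

section Combinatorics

open Function

/-! ### Colourings and total orders compatible with a map -/

section Admissible

variable {X Y Z A : Type*}

/-- The sequence of colours met by the iterates of `x` under `τ`. -/
def colourWord (τ : X → X) (f : X → A) (x : X) : ℕ → A := fun j => f (τ^[j] x)

/-- The shift map on sequences. -/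
def seqShift (s : ℕ → A) : ℕ → A := fun j => s (j + 1)

theorem seqShift_iterate (s : ℕ → A) (k : ℕ) : seqShift^[k] s = fun j => s (j + k) := by
  induction k with
  | zero => rfl
  | succ k ih =>
    rw [iterate_succ_apply', ih]
    funext j
    simp only [seqShift]
    congr 1
    omega

theorem colourWord_apply (τ : X → X) (f : X → A) (x : X) : colourWord τ f (τ x) =
    seqShift (colourWord τ f x) := by
  funext j
  simp [colourWord, seqShift]

theorem colourWord_iterate (τ : X → X) (f : X → A) (k : ℕ) (x : X) :
    colourWord τ f (τ^[k] x) = seqShift^[k] (colourWord τ f x) := by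
  rw [seqShift_iterate]
  funext j
  simp [colourWord, iterate_add_apply]

theorem toLex_seqShift_lt [LinearOrder A] {s t : ℕ → A} (h : toLex s < toLex t)
    (h0 : s 0 = t 0) : toLex (seqShift s) < toLex (seqShift t) := by
  obtain ⟨i, hi, hlt⟩ := h
  obtain _ | i := i
  · exact absurd h0 (ne_of_lt hlt)
  · exact ⟨i, fun j hj => hi (j + 1) (by simpa using hj), hlt⟩

theorem apply_zero_le_of_toLex_lt [LinearOrder A] {s t : ℕ → A} (h : toLex s < toLex t) :
    s 0 ≤ t 0 := by
  obtain ⟨i, hi, hlt⟩ := h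
  obtain _ | i := i
  · exact hlt.le
  · exact (hi 0 (Nat.succ_pos i)).le

/-- A colouring `f` and a strict total order `r` on `X` are compatible with `τ` if colours increase
weakly along `r` and `τ` preserves `r` between elements of equal colour. -/
structure IsAdmissible [LinearOrder A] (τ : X → X) (f : X → A) (r : X → X → Prop) : Prop where
  irrefl : ∀ x, ¬ r x x
  trans : ∀ {x y z}, r x y → r y z → r x z
  total : ∀ {x y}, x ≠ y → r x y ∨ r y x
  mono : ∀ {x y}, r x y → f x ≤ f y
  step : ∀ {x y}, r x y → f x = f y → r (τ x) (τ y)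

/-- The type of pairs of a colouring and an order compatible with `τ`. -/
def AdmissiblePair (A : Type*) [LinearOrder A] (τ : X → X) :=
  {q : (X → A) × (X → X → Prop) // IsAdmissible τ q.1 q.2}

namespace IsAdmissible

variable [LinearOrder A] {τ : X → X} {f : X → A} {r : X → X → Prop}

theorem asymm (h : IsAdmissible τ f r) {x y : X} (hxy : r x y) : ¬ r y x :=
  fun hyx => h.irrefl x (h.trans hxy hyx)

theorem iterate (h : IsAdmissible τ f r) {x y : X} (hxy : r x y)
    (hw : colourWord τ f x = colourWord τ f y) (k : ℕ) : r (τ^[k] x) (τ^[k] y) := by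
  induction k with
  | zero => exact hxy
  | succ k ih =>
    rw [iterate_succ_apply', iterate_succ_apply']
    exact h.step ih (congrFun hw k)

/-- Up to the first place where the words differ, the colours agree and `step` carries `r` along the
orbits; there `mono` decides which letter is smaller. Thus the words determine `r` except between
points with equal words. -/
theorem toLex_colourWord_le (h : IsAdmissible τ f r) {x y : X} (hxy : r x y) :
    toLex (colourWord τ f x) ≤ toLex (colourWord τ f y) := by
  by_contra hlt
  obtain ⟨i, hi, hlt⟩ := not_le.1 hlt
  have key : ∀ k ≤ i, r (τ^[k] x) (τ^[k] y) := by
    intro k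
    induction k with
    | zero => exact fun _ => hxy
    | succ k ih =>
      intro hk
      rw [iterate_succ_apply', iterate_succ_apply']
      exact h.step (ih (by omega)) (hi k (by omega)).symm
  exact absurd (h.mono (key i le_rfl)) (not_le.2 hlt)

theorem of_toLex_lt (h : IsAdmissible τ f r) {x y : X}
    (hxy : toLex (colourWord τ f x) < toLex (colourWord τ f y)) : r x y := by
  rcases h.total (x := x) (y := y) (by rintro rfl; exact lt_irrefl _ hxy) with h1 | h1
  · exact h1
  · exact absurd (h.toLex_colourWord_le h1) (not_le.2 hxy)

/-- Otherwise `x, τ^[k] x, τ^[2k] x, …` is strictly monotone for `r`, yet it returns to `x` after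
`p` steps. This is why cycles spell primitive words. -/
theorem iterate_eq_of_colourWord_eq (h : IsAdmissible τ f r) {x : X} {p : ℕ}
    (hp : 0 < p) (hx : IsPeriodicPt τ p x) {k : ℕ}
    (hk : colourWord τ f (τ^[k] x) = colourWord τ f x) : τ^[k] x = x := by
  by_contra hne
  have per : τ^[k * p] x = x := by
    have := hx.const_mul k
    rwa [IsPeriodicPt, IsFixedPt] at this
  have hword : ∀ m, colourWord τ f (τ^[k * m] x) = colourWord τ f x := by
    intro m
    induction m with
    | zero => rfl
    | succ m ih => rw [Nat.mul_succ, iterate_add_apply, colourWord_iterate, hk,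
        ← colourWord_iterate, ih]
  rcases h.total hne with h1 | h1
  · have : ∀ m, 0 < m → r (τ^[k * m] x) x := by
      intro m hm
      induction m with
      | zero => omega
      | succ m ih =>
        have h2 := h.iterate h1 hk (k * m)
        rw [← iterate_add_apply] at h2
        rcases Nat.eq_zero_or_pos m with rfl | hm'
        · simpa using h1
        · exact h.trans h2 (ih hm')
    exact h.irrefl x (by simpa [per] using this p hp)
  · have : ∀ m, 0 < m → r x (τ^[k * m] x) := by
      intro m hm
      induction m with
      | zero => omega
      | succ m ih =>
        have h2 := h.iterate h1 hk.symm (k * m)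
        rw [← iterate_add_apply] at h2
        rcases Nat.eq_zero_or_pos m with rfl | hm'
        · simpa using h1
        · exact h.trans (ih hm') h2
    exact h.irrefl x (by simpa [per] using this p hp)

theorem minimalPeriod_colourWord (h : IsAdmissible τ f r) {x : X} {p : ℕ}
    (hp : 0 < p) (hx : IsPeriodicPt τ p x) :
    minimalPeriod seqShift (colourWord τ f x) = minimalPeriod τ x := by
  apply Nat.dvd_antisymm
  · apply IsPeriodicPt.minimalPeriod_dvd
    rw [IsPeriodicPt, IsFixedPt, ← colourWord_iterate, iterate_minimalPeriod]
  · apply IsPeriodicPt.minimalPeriod_dvd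
    refine h.iterate_eq_of_colourWord_eq hp hx ?_
    rw [colourWord_iterate, iterate_minimalPeriod]

end IsAdmissible

end Admissible

theorem iterate_eq_iterate_iff_mod {X : Type*} {g : X → X} {x : X}
    (hpos : 0 < minimalPeriod g x) {j k : ℕ} :
    g^[j] x = g^[k] x ↔ j % minimalPeriod g x = k % minimalPeriod g x := by
  rw [← iterate_mod_minimalPeriod_eq (n := j), ← iterate_mod_minimalPeriod_eq (n := k)]
  exact iterate_eq_iterate_iff_of_lt_minimalPeriod (Nat.mod_lt _ hpos) (Nat.mod_lt _ hpos)

/-! ### Finite orders and ranks -/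

section Rank

/-- The number of predecessors of `y` under the relation `r`. -/
noncomputable def relRank {Y : Type*} (r : Y → Y → Prop) (y : Y) : ℕ := {x | r x y}.ncard

variable {Y A : Type*} [Finite Y] [LinearOrder A] {τ : Y → Y} {f : Y → A} {r : Y → Y → Prop}

theorem IsAdmissible.relRank_lt (h : IsAdmissible τ f r) {x y : Y} (hxy : r x y) :
    relRank r x < relRank r y := by
  refine Set.ncard_lt_ncard ⟨fun z hz => h.trans hz hxy, fun hs => ?_⟩ (Set.toFinite _)
  exact h.irrefl x (hs hxy)

theorem IsAdmissible.relRank_lt_iff (h : IsAdmissible τ f r) {x y : Y} :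
    relRank r x < relRank r y ↔ r x y := by
  refine ⟨fun hlt => ?_, h.relRank_lt⟩
  rcases h.total (x := x) (y := y) (by rintro rfl; exact lt_irrefl _ hlt) with h1 | h1
  · exact h1
  · exact absurd (h.relRank_lt h1) hlt.asymm

theorem IsAdmissible.relRank_inj (h : IsAdmissible τ f r) {x y : Y}
    (hxy : relRank r x = relRank r y) : x = y := by
  by_contra hne
  rcases h.total hne with h1 | h1
  · exact (h.relRank_lt h1).ne hxy
  · exact (h.relRank_lt h1).ne' hxy

theorem IsAdmissible.exists_max (h : IsAdmissible τ f r) {S : Set Y} (hS : S.Nonempty) :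
    ∃ y ∈ S, ∀ x ∈ S, ¬ r y x := by
  obtain ⟨y, hy, hmax⟩ := Set.exists_max_image S (relRank r) (Set.toFinite _) hS
  exact ⟨y, hy, fun x hx hr => absurd (h.relRank_lt hr) (not_lt.2 (hmax x hx))⟩

end Rank

/-! ### Inserting one more cycle into a compatible pair -/

section Extension

variable {Y Z A : Type*} {τ : Y → Y} {ρ : Z → Z} {z₀ : Z}

theorem iterate_sumMap_inl (k : ℕ) (y : Y) :
    (Sum.map τ ρ)^[k] (Sum.inl y) = Sum.inl (τ^[k] y) := by
  induction k with
  | zero => rfl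
  | succ k ih => simp only [iterate_succ_apply', ih, Sum.map_inl]

theorem iterate_sumMap_inr (k : ℕ) (z : Z) :
    (Sum.map τ ρ)^[k] (Sum.inr z) = Sum.inr (ρ^[k] z) := by
  induction k with
  | zero => rfl
  | succ k ih => simp only [iterate_succ_apply', ih, Sum.map_inr]

theorem colourWord_inl (f : Y ⊕ Z → A) (y : Y) :
    colourWord (Sum.map τ ρ) f (Sum.inl y) = colourWord τ (fun y => f (Sum.inl y)) y := by
  funext j
  simp [colourWord, iterate_sumMap_inl]

theorem colourWord_inr (f : Y ⊕ Z → A) (z : Z) :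
    colourWord (Sum.map τ ρ) f (Sum.inr z) = colourWord ρ (fun z => f (Sum.inr z)) z := by
  funext j
  simp [colourWord, iterate_sumMap_inr]

/-- An exponent taking the base point of a cycle to a given element. -/
noncomputable def cycleIndex (hz : ∀ z, ∃ j : ℕ, ρ^[j] z₀ = z) (z : Z) : ℕ := (hz z).choose

theorem iterate_cycleIndex (hz : ∀ z, ∃ j : ℕ, ρ^[j] z₀ = z) (z : Z) :
    ρ^[cycleIndex hz z] z₀ = z := (hz z).choose_spec

variable (hz : ∀ z, ∃ j : ℕ, ρ^[j] z₀ = z)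

/-- The chosen exponent is only determined modulo the cycle length; this is harmless on points of
the same minimal period. -/
theorem iterate_cycleIndex_congr (hl : 0 < minimalPeriod ρ z₀) {X : Type*} {g : X → X} {x : X}
    (hx : minimalPeriod g x = minimalPeriod ρ z₀) (j : ℕ) :
    g^[cycleIndex hz (ρ^[j] z₀)] x = g^[j] x := by
  rw [iterate_eq_iterate_iff_mod (by omega), hx, ← iterate_eq_iterate_iff_mod hl,
    iterate_cycleIndex]

theorem iterate_cycleIndex_apply (hl : 0 < minimalPeriod ρ z₀) {X : Type*} {g : X → X} {x : X}
    (hx : minimalPeriod g x = minimalPeriod ρ z₀) (z : Z) :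
    g^[cycleIndex hz (ρ z)] x = g (g^[cycleIndex hz z] x) := by
  have := iterate_cycleIndex_congr hz hl hx (cycleIndex hz z + 1)
  rwa [iterate_succ_apply', iterate_succ_apply', iterate_cycleIndex] at this

/-- The colouring of `Z` that spells the sequence `s` from the base point. -/
noncomputable def spellColour (s : ℕ → A) (z : Z) : A := s (cycleIndex hz z)

theorem colourWord_spellColour (hl : 0 < minimalPeriod ρ z₀) {s : ℕ → A}
    (hs : minimalPeriod seqShift s = minimalPeriod ρ z₀) (z : Z) :
    colourWord ρ (spellColour hz s) z = seqShift^[cycleIndex hz z] s := by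
  funext j
  have h1 : seqShift^[cycleIndex hz (ρ^[j] z)] s = seqShift^[j + cycleIndex hz z] s := by
    have := iterate_cycleIndex_congr hz hl hs (j + cycleIndex hz z)
    rwa [iterate_add_apply, iterate_cycleIndex] at this
  have h2 := congrFun h1 0
  simp only [seqShift_iterate, zero_add] at h2
  rw [colourWord, spellColour, h2, seqShift_iterate]

theorem colourWord_spellColour_base (hl : 0 < minimalPeriod ρ z₀) {s : ℕ → A}
    (hs : minimalPeriod seqShift s = minimalPeriod ρ z₀) :
    colourWord ρ (spellColour hz s) z₀ = s := by
  rw [colourWord_spellColour hz hl hs]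
  exact iterate_cycleIndex_congr hz hl hs 0

theorem colourWord_spellColour_injective (hl : 0 < minimalPeriod ρ z₀) {s : ℕ → A}
    (hs : minimalPeriod seqShift s = minimalPeriod ρ z₀) :
    Injective (colourWord ρ (spellColour hz s)) := by
  intro z z' h
  rw [colourWord_spellColour hz hl hs, colourWord_spellColour hz hl hs,
    iterate_eq_iterate_iff_mod (by omega), hs, ← iterate_eq_iterate_iff_mod hl,
    iterate_cycleIndex, iterate_cycleIndex] at h
  exact h

variable [LinearOrder A]

/-- The order on `Y ⊕ Z` by colour words, ties being broken by heights. -/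
def wordHeightRel (T : Y ⊕ Z → Y ⊕ Z) (F : Y ⊕ Z → A) (h : Y ⊕ Z → ℕ) (x x' : Y ⊕ Z) : Prop :=
  toLex (toLex (colourWord T F x), h x) < toLex (toLex (colourWord T F x'), h x')

/-- The tie-breaking heights: elements of `Y` get odd heights, those of `Z` even ones. -/
noncomputable def extHeight (τ : Y → Y) (r : Y → Y → Prop) (c : Option Y) : Y ⊕ Z → ℕ
  | Sum.inl y => 2 * relRank r y + 1
  -- The new cycle runs alongside the orbit of `y₀`, each point just above its partner. The value
  -- `0` puts it below every point of `Y` with the same word, and parity rules out ties between `Y`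
  -- and `Z`.
  | Sum.inr z => c.elim 0 fun y₀ => 2 * relRank r (τ^[cycleIndex hz z] y₀) + 2

theorem wordHeightRel_iff {T : Y ⊕ Z → Y ⊕ Z} {F : Y ⊕ Z → A} {h : Y ⊕ Z → ℕ} {x x' : Y ⊕ Z} :
    wordHeightRel T F h x x' ↔ toLex (colourWord T F x) < toLex (colourWord T F x') ∨
      (colourWord T F x = colourWord T F x' ∧ h x < h x') := by
  rw [wordHeightRel, Prod.Lex.toLex_lt_toLex]
  simp

theorem isAdmissible_wordHeightRel {T : Y ⊕ Z → Y ⊕ Z} {F : Y ⊕ Z → A} {h : Y ⊕ Z → ℕ}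
    (hinj : ∀ x x', colourWord T F x = colourWord T F x' → h x = h x' → x = x')
    (hstep : ∀ x x', colourWord T F x = colourWord T F x' → h x < h x' → h (T x) < h (T x')) :
    IsAdmissible T F (wordHeightRel T F h) where
  irrefl x := lt_irrefl _
  trans h1 h2 := lt_trans h1 h2
  total {x y} hne := by
    rcases lt_trichotomy (toLex (toLex (colourWord T F x), h x))
      (toLex (toLex (colourWord T F y), h y)) with h1 | h1 | h1
    · exact Or.inl h1
    · have h2 := Prod.ext_iff.1 (toLex_inj.1 h1)
      exact absurd (hinj x y (toLex_inj.1 h2.1) h2.2) hne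
    · exact Or.inr h1
  mono {x y} hxy := by
    rcases wordHeightRel_iff.1 hxy with h1 | h1
    · exact apply_zero_le_of_toLex_lt h1
    · exact (congrFun h1.1 0).le
  step {x y} hxy h0 := by
    rw [wordHeightRel_iff, colourWord_apply, colourWord_apply]
    rcases wordHeightRel_iff.1 hxy with h1 | h1
    · exact Or.inl (toLex_seqShift_lt h1 h0)
    · exact Or.inr ⟨by rw [h1.1], hstep x y h1.1 h1.2⟩

/-- The sequence spelled by the new cycle: a new one, or that of an element of `Y`. -/
def insertionWord (τ : Y → Y) (f : Y → A) {l : ℕ} :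
    {s : ℕ → A // minimalPeriod seqShift s = l} ⊕ {y : Y // minimalPeriod τ y = l} → ℕ → A
  | Sum.inl s => s
  | Sum.inr y => colourWord τ f y

/-- The element of `Y` just above which the base point is inserted, if any. -/
def insertionPoint {l : ℕ} :
    {s : ℕ → A // minimalPeriod seqShift s = l} ⊕ {y : Y // minimalPeriod τ y = l} → Option Y
  | Sum.inl _ => none
  | Sum.inr y => some y

variable {f : Y → A} {r : Y → Y → Prop}

theorem minimalPeriod_insertionWord (h : IsAdmissible τ f r) {l : ℕ} (hl : 0 < l)
    (c : {s : ℕ → A // minimalPeriod seqShift s = l} ⊕ {y : Y // minimalPeriod τ y = l}) :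
    minimalPeriod seqShift (insertionWord τ f c) = l := by
  rcases c with c | y
  · exact c.2
  · have hy := y.2
    rw [insertionWord, h.minimalPeriod_colourWord (x := (y : Y)) hl ?_, hy]
    have := isPeriodicPt_minimalPeriod τ (y : Y)
    rwa [hy] at this

/-- The extension of a compatible pair on `Y` to `Y ⊕ Z`. -/
noncomputable def extPair (f : Y → A) (r : Y → Y → Prop)
    (c : {s : ℕ → A // minimalPeriod seqShift s = minimalPeriod ρ z₀} ⊕
      {y : Y // minimalPeriod τ y = minimalPeriod ρ z₀}) :
    (Y ⊕ Z → A) × (Y ⊕ Z → Y ⊕ Z → Prop) :=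
  (Sum.elim f (spellColour hz (insertionWord τ f c)),
    wordHeightRel (Sum.map τ ρ) (Sum.elim f (spellColour hz (insertionWord τ f c)))
      (extHeight hz τ r (insertionPoint c)))

theorem IsAdmissible.restrict {F : Y ⊕ Z → A} {R : Y ⊕ Z → Y ⊕ Z → Prop}
    (h : IsAdmissible (Sum.map τ ρ) F R) :
    IsAdmissible τ (fun y => F (Sum.inl y)) (fun y y' => R (Sum.inl y) (Sum.inl y')) where
  irrefl _ := h.irrefl _
  trans h1 h2 := h.trans h1 h2
  total hne := h.total (fun he => hne (Sum.inl_injective he))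
  mono h1 := h.mono h1
  step h1 h2 := h.step h1 h2

variable [Finite Y]

/-- Only ties between equal words need checking. Within `Y` heights follow `r`, within `Z` words are
distinct by primitivity, and across the two a point of `Z` behaves like its partner in the orbit of
`y₀`, which moves in step with it. -/
theorem isAdmissible_extPair (hl : 0 < minimalPeriod ρ z₀) (h : IsAdmissible τ f r)
    (c : {s : ℕ → A // minimalPeriod seqShift s = minimalPeriod ρ z₀} ⊕
      {y : Y // minimalPeriod τ y = minimalPeriod ρ z₀}) :
    IsAdmissible (Sum.map τ ρ) (extPair hz f r c).1 (extPair hz f r c).2 := by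
  have hs := minimalPeriod_insertionWord h hl c
  have hinj := colourWord_spellColour_injective hz hl hs
  have hle : ∀ {x y : Y}, colourWord τ f x = colourWord τ f y →
      relRank r x ≤ relRank r y → relRank r (τ x) ≤ relRank r (τ y) := by
    intro x y hw hxy
    rcases hxy.lt_or_eq with h1 | h1
    · exact (h.relRank_lt (h.step (h.relRank_lt_iff.1 h1) (congrFun hw 0))).le
    · rw [h.relRank_inj h1]
  have hlt : ∀ {x y : Y}, colourWord τ f x = colourWord τ f y →
      relRank r x < relRank r y → relRank r (τ x) < relRank r (τ y) := fun hw hxy =>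
    h.relRank_lt (h.step (h.relRank_lt_iff.1 hxy) (congrFun hw 0))
  have hw : ∀ (z : Z) (y : {y : Y // minimalPeriod τ y = minimalPeriod ρ z₀}), c = Sum.inr y →
      colourWord ρ (spellColour hz (insertionWord τ f c)) z =
        colourWord τ f (τ^[cycleIndex hz z] y) := by
    rintro z y rfl
    rw [colourWord_spellColour hz hl hs, colourWord_iterate, insertionWord]
  refine isAdmissible_wordHeightRel ?_ ?_
  · rintro (y | z) (y' | z') hword hh
    · simp only [extHeight] at hh
      rw [h.relRank_inj (show relRank r y = relRank r y' by omega)]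
    · rcases c with c | c <;> simp [extHeight, insertionPoint] at hh
      omega
    · rcases c with c | c <;> simp [extHeight, insertionPoint] at hh
      omega
    · rw [colourWord_inr, colourWord_inr] at hword
      exact congrArg _ (hinj hword)
  · rintro (y | z) (y' | z') hword hh
    · rw [colourWord_inl, colourWord_inl] at hword
      simp only [extHeight, Sum.map_inl] at hh ⊢
      have := hlt hword (by omega)
      omega
    · rw [colourWord_inl, colourWord_inr] at hword
      rcases c with c | c
      · simp [extHeight, insertionPoint] at hh
      · simp only [extHeight, insertionPoint, Sum.map_inl, Sum.map_inr, Option.elim] at hh ⊢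
        rw [iterate_cycleIndex_apply hz hl c.2]
        have := hle (hword.trans (hw z' c rfl)) (by omega)
        omega
    · rw [colourWord_inl, colourWord_inr] at hword
      rcases c with c | c
      · simp [extHeight, insertionPoint]
      · simp only [extHeight, insertionPoint, Sum.map_inl, Sum.map_inr, Option.elim] at hh ⊢
        rw [iterate_cycleIndex_apply hz hl c.2]
        have := hlt ((hw z c rfl).symm.trans hword) (by omega)
        omega
    · rw [colourWord_inr, colourWord_inr] at hword
      rw [hinj hword] at hh
      exact absurd hh (lt_irrefl _)

theorem extPair_inl_inl_iff (h : IsAdmissible τ f r)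
    (c : {s : ℕ → A // minimalPeriod seqShift s = minimalPeriod ρ z₀} ⊕
      {y : Y // minimalPeriod τ y = minimalPeriod ρ z₀}) (y y' : Y) :
    (extPair hz f r c).2 (Sum.inl y) (Sum.inl y') ↔ r y y' := by
  have key : ∀ y y', r y y' → (extPair hz f r c).2 (Sum.inl y) (Sum.inl y') := by
    intro y y' hr
    simp only [extPair]
    rw [wordHeightRel_iff, colourWord_inl, colourWord_inl]
    rcases (h.toLex_colourWord_le hr).lt_or_eq with h1 | h1
    · exact Or.inl h1
    · refine Or.inr ⟨toLex_inj.1 h1, ?_⟩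
      have := h.relRank_lt hr
      simp only [extHeight]
      omega
  refine ⟨fun hr => ?_, key y y'⟩
  rcases h.total (x := y) (y := y') (by rintro rfl; exact lt_irrefl _ hr) with h1 | h1
  · exact h1
  · exact absurd (key _ _ h1) (lt_asymm hr)

/-- The insertion data can be read off at the base point: its word is spelled by the colouring, and
the points of `Y` with that word lying below it are those of rank at most that of `y₀`, or none at
all. -/
theorem extPair_injective (hl : 0 < minimalPeriod ρ z₀) {f' : Y → A} {r' : Y → Y → Prop}
    (h : IsAdmissible τ f r) (h' : IsAdmissible τ f' r')
    {c c' : {s : ℕ → A // minimalPeriod seqShift s = minimalPeriod ρ z₀} ⊕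
      {y : Y // minimalPeriod τ y = minimalPeriod ρ z₀}}
    (he : extPair hz f r c = extPair hz f' r' c') : f = f' ∧ r = r' ∧ c = c' := by
  have hf : f = f' := funext fun y => congrFun (congrArg Prod.fst he) (Sum.inl y)
  have hr : r = r' := by
    funext y y'
    rw [← extPair_inl_inl_iff hz h c, ← extPair_inl_inl_iff hz h' c', he]
  subst hf hr
  refine ⟨rfl, rfl, ?_⟩
  have hs := minimalPeriod_insertionWord h hl c
  have hs' := minimalPeriod_insertionWord h hl c'
  have hF := congrArg Prod.fst he
  have hcol : spellColour hz (insertionWord τ f c) = spellColour hz (insertionWord τ f c') :=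
    funext fun z => congrFun hF (Sum.inr z)
  have hword : insertionWord τ f c = insertionWord τ f c' := by
    rw [← colourWord_spellColour_base hz hl hs, hcol, colourWord_spellColour_base hz hl hs']
  have hR : ∀ y, (extPair hz f r c).2 (Sum.inl y) (Sum.inr z₀) ↔
      (extPair hz f r c').2 (Sum.inl y) (Sum.inr z₀) := fun y => by rw [he]
  have hcmp : ∀ c : {s : ℕ → A // minimalPeriod seqShift s = minimalPeriod ρ z₀} ⊕
      {y : Y // minimalPeriod τ y = minimalPeriod ρ z₀}, ∀ y,
      colourWord τ f y = insertionWord τ f c →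
      ((extPair hz f r c).2 (Sum.inl y) (Sum.inr z₀) ↔
        ∃ y₀, c = Sum.inr y₀ ∧ relRank r y ≤ relRank r y₀) := by
    intro c y hy
    simp only [extPair]
    rw [wordHeightRel_iff, colourWord_inl, colourWord_inr]
    change toLex (colourWord τ f y) < toLex (colourWord ρ (spellColour hz (insertionWord τ f c)) z₀) ∨
      colourWord τ f y = colourWord ρ (spellColour hz (insertionWord τ f c)) z₀ ∧ _ ↔ _
    rw [colourWord_spellColour_base hz hl (minimalPeriod_insertionWord h hl c), hy]
    refine (or_iff_right (lt_irrefl (toLex (insertionWord τ f c)))).trans ?_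
    rcases c with c | c
    · simp [extHeight, insertionPoint]
    · have h0 : τ^[cycleIndex hz z₀] c = (c : Y) := iterate_cycleIndex_congr hz hl c.2 0
      simp only [extHeight, insertionPoint, Option.elim, h0, true_and, Sum.inr.injEq,
        exists_eq_left']
      omega
  rcases c with c | c <;> rcases c' with c' | c'
  · exact congrArg _ (Subtype.ext hword)
  · have h1 := (hcmp (Sum.inr c') c' rfl).2 ⟨c', rfl, le_rfl⟩
    obtain ⟨y, hy, -⟩ := (hcmp (Sum.inl c) c' hword.symm).1 ((hR c').2 h1)
    cases hy
  · have h1 := (hcmp (Sum.inr c) c rfl).2 ⟨c, rfl, le_rfl⟩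
    obtain ⟨y, hy, -⟩ := (hcmp (Sum.inl c') c hword).1 ((hR c).1 h1)
    cases hy
  · have h1 := (hcmp (Sum.inr c') c' rfl).2 ⟨c', rfl, le_rfl⟩
    have h2 := (hcmp (Sum.inr c) c rfl).2 ⟨c, rfl, le_rfl⟩
    obtain ⟨y, hy, hle⟩ := (hcmp (Sum.inr c) c' hword.symm).1 ((hR c').2 h1)
    obtain ⟨y', hy', hle'⟩ := (hcmp (Sum.inr c') c hword).1 ((hR c).1 h2)
    cases hy
    cases hy'
    exact congrArg _ (Subtype.ext (h.relRank_inj (le_antisymm hle' hle)))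

/-- The insertion point is the `r`-greatest element of `Y` that shares the word of `z₀` and lies
below it; if there is none, the cycle sits in the bottom slot. Comparisons at other points of the
cycle are transported to `z₀` by iteration. -/
theorem exists_extPair_eq (hl : 0 < minimalPeriod ρ z₀) (hτ : ∀ y, 0 < minimalPeriod τ y)
    {F : Y ⊕ Z → A} {R : Y ⊕ Z → Y ⊕ Z → Prop} (h : IsAdmissible (Sum.map τ ρ) F R) :
    ∃ c : {s : ℕ → A // minimalPeriod seqShift s = minimalPeriod ρ z₀} ⊕
      {y : Y // minimalPeriod τ y = minimalPeriod ρ z₀},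
      extPair hz (fun y => F (Sum.inl y)) (fun y y' => R (Sum.inl y) (Sum.inl y')) c = (F, R) := by
  set f : Y → A := fun y => F (Sum.inl y) with hf
  set g : Z → A := fun z => F (Sum.inr z) with hg
  set r : Y → Y → Prop := fun y y' => R (Sum.inl y) (Sum.inl y') with hr
  have hres : IsAdmissible τ f r := h.restrict
  have hFfg : F = Sum.elim f g := by
    funext x
    rcases x with x | x <;> rfl
  have hperz : minimalPeriod (Sum.map τ ρ) (Sum.inr z₀ : Y ⊕ Z) = minimalPeriod ρ z₀ := by
    apply Nat.dvd_antisymm <;> apply IsPeriodicPt.minimalPeriod_dvd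
    · rw [IsPeriodicPt, IsFixedPt, iterate_sumMap_inr, iterate_minimalPeriod]
    · have := iterate_minimalPeriod (f := Sum.map τ ρ) (x := (Sum.inr z₀ : Y ⊕ Z))
      rw [iterate_sumMap_inr] at this
      exact Sum.inr_injective this
  have hs : minimalPeriod seqShift (colourWord ρ g z₀) = minimalPeriod ρ z₀ := by
    have := h.minimalPeriod_colourWord hl (x := Sum.inr z₀)
      (hperz ▸ isPeriodicPt_minimalPeriod _ _)
    rwa [colourWord_inr, hperz] at this
  have hspell : spellColour hz (colourWord ρ g z₀) = g := by
    funext z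
    rw [spellColour, colourWord, iterate_cycleIndex]
  have hback : ∀ z : Z, ∃ m, ρ^[m] z = z₀ := by
    intro z
    obtain ⟨j, rfl⟩ := hz z
    refine ⟨minimalPeriod ρ z₀ * j - j, ?_⟩
    rw [← iterate_add_apply, Nat.sub_add_cancel (Nat.le_mul_of_pos_left j hl)]
    exact (isPeriodicPt_minimalPeriod ρ z₀).mul_const j
  -- the elements of `Y` with the word of the base point that lie below it
  set S : Set Y := {y | colourWord τ f y = colourWord ρ g z₀ ∧ R (Sum.inl y) (Sum.inr z₀)} with hS
  have hmemS : ∀ {y z m}, ρ^[m] z = z₀ → colourWord τ f y = colourWord ρ g z →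
      R (Sum.inl y) (Sum.inr z) → τ^[m] y ∈ S := by
    intro y z m hm hw hyz
    refine ⟨by rw [colourWord_iterate, hw, ← colourWord_iterate, hm], ?_⟩
    have := h.iterate hyz (by rw [colourWord_inl, colourWord_inr]; exact hw) m
    rwa [iterate_sumMap_inl, iterate_sumMap_inr, hm] at this
  have finish : ∀ c : {s : ℕ → A // minimalPeriod seqShift s = minimalPeriod ρ z₀} ⊕
      {y : Y // minimalPeriod τ y = minimalPeriod ρ z₀},
      insertionWord τ f c = colourWord ρ g z₀ →
      (∀ y z, colourWord τ f y = colourWord ρ g z →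
        extHeight hz τ r (insertionPoint c) (Sum.inl y) <
          extHeight hz τ r (insertionPoint c) (Sum.inr z) → R (Sum.inl y) (Sum.inr z)) →
      (∀ y z, colourWord τ f y = colourWord ρ g z →
        extHeight hz τ r (insertionPoint c) (Sum.inr z) <
          extHeight hz τ r (insertionPoint c) (Sum.inl y) → R (Sum.inr z) (Sum.inl y)) →
      extPair hz f r c = (F, R) := by
    intro c hc h1 h2
    have hadm := isAdmissible_extPair hz hl hres c
    have hfst : (extPair hz f r c).1 = F := by
      rw [hFfg]
      simp only [extPair]
      rw [hc, hspell]
    have hinj := colourWord_spellColour_injective hz hl hs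
    rw [hspell] at hinj
    -- One implication suffices, both relations being strict and total.
    have himp : ∀ x x', (extPair hz f r c).2 x x' → R x x' := by
      intro x x' hx
      change wordHeightRel _ (extPair hz f r c).1 _ _ _ at hx
      rw [hfst, wordHeightRel_iff] at hx
      rcases hx with hx | ⟨hx, hh⟩
      · exact h.of_toLex_lt hx
      · rcases x with y | z <;> rcases x' with y' | z'
        · simp only [extHeight] at hh
          exact hres.relRank_lt_iff.1 (by omega)
        · rw [colourWord_inl, colourWord_inr] at hx
          exact h1 _ _ hx hh
        · rw [colourWord_inl, colourWord_inr] at hx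
          exact h2 _ _ hx.symm hh
        · rw [colourWord_inr, colourWord_inr] at hx
          rw [hinj hx] at hh
          exact absurd hh (lt_irrefl _)
    refine Prod.ext hfst ?_
    funext x x'
    refine propext ⟨himp x x', fun hx => ?_⟩
    rcases hadm.total (x := x) (y := x') (by rintro rfl; exact h.irrefl _ hx) with h3 | h3
    · exact h3
    · exact absurd (himp _ _ h3) (h.asymm hx)
  rcases S.eq_empty_or_nonempty with hemp | hne
  · refine ⟨Sum.inl ⟨colourWord ρ g z₀, hs⟩, finish _ rfl ?_ ?_⟩
    · intro y z _ hh
      simp [extHeight, insertionPoint] at hh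
    · intro y z hw _
      rcases h.total (x := Sum.inr z) (y := Sum.inl y) (by simp) with h3 | h3
      · exact h3
      · obtain ⟨m, hm⟩ := hback z
        have := hmemS hm hw h3
        rw [hemp] at this
        exact this.elim
  · obtain ⟨y₀, hy₀, hmax⟩ := hres.exists_max hne
    have hper : minimalPeriod τ y₀ = minimalPeriod ρ z₀ := by
      rw [← hs, ← hy₀.1, hres.minimalPeriod_colourWord (hτ y₀) (isPeriodicPt_minimalPeriod _ _)]
    have hwz : ∀ z, colourWord τ f (τ^[cycleIndex hz z] y₀) = colourWord ρ g z := by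
      intro z
      rw [colourWord_iterate, hy₀.1, ← colourWord_iterate, iterate_cycleIndex]
    refine ⟨Sum.inr ⟨y₀, hper⟩, finish _ hy₀.1 ?_ ?_⟩
    · intro y z hw hh
      simp only [extHeight, insertionPoint, Option.elim] at hh
      have hR : R (Sum.inl (τ^[cycleIndex hz z] y₀)) (Sum.inr z) := by
        have := h.iterate hy₀.2 (by rw [colourWord_inl, colourWord_inr]; exact hy₀.1)
          (cycleIndex hz z)
        rwa [iterate_sumMap_inl, iterate_sumMap_inr, iterate_cycleIndex] at this
      have hle : relRank r y ≤ relRank r (τ^[cycleIndex hz z] y₀) := by omega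
      rcases hle.lt_or_eq with h3 | h3
      · exact h.trans (hres.relRank_lt_iff.1 h3) hR
      · rwa [hres.relRank_inj h3]
    · intro y z hw hh
      simp only [extHeight, insertionPoint, Option.elim] at hh
      rcases h.total (x := Sum.inr z) (y := Sum.inl y) (by simp) with h3 | h3
      · exact h3
      -- If `y` were below `z`, moving both forward until `z` reaches `z₀` would give an element of
      -- `S` strictly above `y₀`.
      · obtain ⟨m, hm⟩ := hback z
        have h4 := hmemS hm hw h3
        have h5 : r (τ^[cycleIndex hz z] y₀) y := hres.relRank_lt_iff.1 (by omega)
        have h6 := hres.iterate h5 ((hwz z).trans hw.symm) m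
        have h7 : τ^[m] (τ^[cycleIndex hz z] y₀) = y₀ := by
          rw [← iterate_add_apply]
          have : τ^[m + cycleIndex hz z] y₀ = τ^[0] y₀ := by
            rw [iterate_eq_iterate_iff_mod (hτ y₀), hper, ← iterate_eq_iterate_iff_mod hl,
              iterate_add_apply, iterate_cycleIndex, hm, iterate_zero_apply]
          exact this
        rw [h7] at h6
        exact absurd h6 (hmax _ h4)

/-- For each primitive word there is one slot more than there are points of `Y` carrying that word;
the sum runs over all words. -/
theorem card_admissiblePair_sumMap (hz : ∀ z, ∃ j : ℕ, ρ^[j] z₀ = z)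
    (hl : 0 < minimalPeriod ρ z₀) (hτ : ∀ y, 0 < minimalPeriod τ y)
    [Finite {s : ℕ → A // minimalPeriod seqShift s = minimalPeriod ρ z₀}] :
    Nat.card (AdmissiblePair A (Sum.map τ ρ)) = Nat.card (AdmissiblePair A τ) *
      (Nat.card {s : ℕ → A // minimalPeriod seqShift s = minimalPeriod ρ z₀} +
        Nat.card {y : Y // minimalPeriod τ y = minimalPeriod ρ z₀}) := by
  rw [← Nat.card_sum, ← Nat.card_prod]
  symm
  refine Nat.card_congr (Equiv.ofBijective
    (fun q => ⟨extPair hz q.1.1.1 q.1.1.2 q.2, isAdmissible_extPair hz hl q.1.2 q.2⟩) ⟨?_, ?_⟩)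
  · rintro ⟨⟨⟨f, r⟩, h⟩, c⟩ ⟨⟨⟨f', r'⟩, h'⟩, c'⟩ he
    obtain ⟨rfl, rfl, rfl⟩ := extPair_injective hz hl h h' (Subtype.ext_iff.1 he)
    rfl
  · rintro ⟨⟨F, R⟩, h⟩
    obtain ⟨c, hc⟩ := exists_extPair_eq hz hl hτ h
    exact ⟨(⟨(_, _), h.restrict⟩, c), Subtype.ext hc⟩

end Extension

/-! ### Counting primitive words -/

section PrimitiveWords

/-- The number of sequences over `a` letters with minimal period `l` under the shift. -/
noncomputable def primCount (a l : ℕ) : ℕ :=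
  Nat.card {s : ℕ → Fin a // minimalPeriod seqShift s = l}

/-- Periodic sequences are determined by their first `l` letters. -/
noncomputable def periodicSeqEquiv (A : Type*) (l : ℕ) [NeZero l] :
    {s : ℕ → A // IsPeriodicPt seqShift l s} ≃ (Fin l → A) where
  toFun s i := s.1 i
  invFun g := ⟨fun j => g (Fin.ofNat l j), by
    rw [IsPeriodicPt, IsFixedPt, seqShift_iterate]
    funext j
    congr 1
    ext
    simp⟩
  left_inv := by
    rintro ⟨s, hs⟩
    ext j
    rw [IsPeriodicPt, IsFixedPt] at hs
    simp only [Fin.val_ofNat]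
    have h1 : ∀ m, s (j % l + l * m) = s (j % l) := by
      intro m
      induction m with
      | zero => rfl
      | succ m ih =>
        have := congrFun hs (j % l + l * m)
        simp only [seqShift_iterate] at this
        rw [Nat.mul_succ, ← add_assoc, this, ih]
    have := h1 (j / l)
    rw [Nat.mod_add_div] at this
    exact this.symm
  right_inv g := by
    funext i
    simp

instance finite_periodicSeq (A : Type*) [Finite A] (l : ℕ) [NeZero l] :
    Finite {s : ℕ → A // IsPeriodicPt seqShift l s} :=
  Finite.of_equiv _ (periodicSeqEquiv A l).symm

theorem finite_minimalPeriod_seqShift (A : Type*) [Finite A] {l : ℕ} (hl : 0 < l) :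
    Finite {s : ℕ → A // minimalPeriod seqShift s = l} := by
  have : NeZero l := ⟨hl.ne'⟩
  refine Finite.of_injective (β := {s : ℕ → A // IsPeriodicPt seqShift l s})
    (fun s => ⟨s.1, ?_⟩) ?_
  · have := isPeriodicPt_minimalPeriod seqShift s.1
    rwa [s.2] at this
  · intro s t h
    simp only [Subtype.mk.injEq] at h
    exact Subtype.ext h

theorem sum_divisors_primCount (a : ℕ) {l : ℕ} (hl : 0 < l) :
    ∑ d ∈ l.divisors, primCount a d = a ^ l := by
  classical
  have : NeZero l := ⟨hl.ne'⟩
  have hS : {s : ℕ → Fin a | IsPeriodicPt seqShift l s}.Finite :=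
    finite_periodicSeq (Fin a) l
  have h1 : hS.toFinset.card = a ^ l := by
    rw [← Set.ncard_eq_toFinset_card _ hS]
    change Nat.card {s : ℕ → Fin a // IsPeriodicPt seqShift l s} = _
    rw [Nat.card_congr (periodicSeqEquiv (Fin a) l)]
    simp
  rw [← h1, Finset.card_eq_sum_card_fiberwise (f := minimalPeriod seqShift) (t := l.divisors)]
  · refine Finset.sum_congr rfl fun d hd => ?_
    rw [primCount, ← Nat.card_eq_finsetCard]
    refine Nat.card_congr (Equiv.subtypeEquivRight fun s => ?_)
    simp only [Finset.mem_filter, Set.Finite.mem_toFinset, Set.mem_ofPred_eq, iff_and_self]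
    rintro rfl
    exact (isPeriodicPt_minimalPeriod seqShift s).trans_dvd (Nat.dvd_of_mem_divisors hd)
  · intro s hs
    simp only [Set.Finite.coe_toFinset, Set.mem_ofPred_eq] at hs
    simpa using ⟨hs.minimalPeriod_dvd, hl.ne'⟩

/-- The polynomial counting primitive words of length `l`. -/
noncomputable def primPoly (l : ℕ) : Polynomial ℂ :=
  ∑ q ∈ l.divisorsAntidiagonal, (ArithmeticFunction.moebius q.1 : ℂ) • Polynomial.X ^ q.2

theorem eval_primPoly_natCast (a : ℕ) {l : ℕ} (hl : 0 < l) :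
    (primPoly l).eval (a : ℂ) = primCount a l := by
  have h := (ArithmeticFunction.sum_eq_iff_sum_mul_moebius_eq (R := ℂ)
    (f := fun d => (primCount a d : ℂ)) (g := fun d => (a : ℂ) ^ d)).1 (by
      intro n hn
      rw [← Nat.cast_pow, ← sum_divisors_primCount a hn, Nat.cast_sum]) l hl
  rw [← h, primPoly, Polynomial.eval_finsetSum]
  simp [Polynomial.eval_smul]

end PrimitiveWords

/-! ### A permutation built cycle by cycle, and its number of compatible pairs -/

section CycleModel

open Equiv.Perm

theorem coe_permSumCongr {Y Z : Type*} (σ : Equiv.Perm Y) (ρ : Equiv.Perm Z) :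
    ⇑(Equiv.Perm.sumCongr σ ρ) = Sum.map σ ρ := rfl

theorem cycleType_sumCongr {Y Z : Type*} [Fintype Y] [Fintype Z] [DecidableEq Y] [DecidableEq Z]
    (σ : Equiv.Perm Y) (ρ : Equiv.Perm Z) :
    (Equiv.Perm.sumCongr σ ρ).cycleType = σ.cycleType + ρ.cycleType := by
  have h1 : (Equiv.Perm.sumCongr σ (1 : Equiv.Perm Z)) =
      σ.extendDomain (Equiv.ofInjective (Sum.inl : Y → Y ⊕ Z) Sum.inl_injective) := by
    ext x
    rcases x with y | z
    · have := extendDomain_apply_image σ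
        (Equiv.ofInjective (Sum.inl : Y → Y ⊕ Z) Sum.inl_injective) y
      simpa using this.symm
    · rw [extendDomain_apply_not_subtype]
      · rfl
      · simp
  have h2 : (Equiv.Perm.sumCongr (1 : Equiv.Perm Y) ρ) =
      ρ.extendDomain (Equiv.ofInjective (Sum.inr : Z → Y ⊕ Z) Sum.inr_injective) := by
    ext x
    rcases x with y | z
    · rw [extendDomain_apply_not_subtype]
      · rfl
      · simp
    · have := extendDomain_apply_image ρ
        (Equiv.ofInjective (Sum.inr : Z → Y ⊕ Z) Sum.inr_injective) z
      simpa using this.symm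
  have h3 : (Equiv.Perm.sumCongr σ ρ) =
      (Equiv.Perm.sumCongr σ (1 : Equiv.Perm Z)) *
        (Equiv.Perm.sumCongr (1 : Equiv.Perm Y) ρ) := by
    ext x
    rcases x with y | z <;> rfl
  rw [h3, Disjoint.cycleType_mul, h1, h2, cycleType_extendDomain, cycleType_extendDomain]
  rintro (y | z)
  · exact Or.inr rfl
  · exact Or.inl rfl

theorem parts_partition_sumCongr {Y Z : Type*} [Fintype Y] [Fintype Z] [DecidableEq Y]
    [DecidableEq Z] (σ : Equiv.Perm Y) (ρ : Equiv.Perm Z) :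
    (partition (Equiv.Perm.sumCongr σ ρ)).parts =
      σ.partition.parts + ρ.partition.parts := by
  have h1 := σ.support.card_le_univ
  have h2 := ρ.support.card_le_univ
  rw [parts_partition, parts_partition, parts_partition, ← sum_cycleType, cycleType_sumCongr,
    Multiset.sum_add, sum_cycleType, sum_cycleType, Fintype.card_sum,
    show Fintype.card Y + Fintype.card Z - (σ.support.card + ρ.support.card) =
      (Fintype.card Y - σ.support.card) + (Fintype.card Z - ρ.support.card) by omega,
    Multiset.replicate_add]
  abel

theorem parts_partition_finRotate {l : ℕ} (hl : 0 < l) :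
    (finRotate l).partition.parts = {l} := by
  rw [parts_partition, Fintype.card_fin]
  rcases Nat.lt_or_ge l 2 with h | h
  · obtain rfl : l = 1 := by omega
    have : finRotate 1 = 1 := Subsingleton.elim _ _
    rw [this]
    simp
  · rw [cycleType_finRotate_of_le h, ← sum_cycleType, cycleType_finRotate_of_le h]
    simp

theorem iterate_finRotate_zero {l : ℕ} [NeZero l] (j : ℕ) :
    (finRotate l)^[j] 0 = Fin.ofNat l j := by
  induction j with
  | zero => simp
  | succ j ih =>
    rw [iterate_succ_apply', ih]
    rw [finRotate_apply]
    ext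
    simp [Fin.val_add]

theorem minimalPeriod_finRotate {l : ℕ} [NeZero l] (i : Fin l) :
    minimalPeriod (finRotate l) i = l := by
  have h0 : minimalPeriod (finRotate l) 0 = l := by
    apply Nat.dvd_antisymm
    · apply IsPeriodicPt.minimalPeriod_dvd
      rw [IsPeriodicPt, IsFixedPt, iterate_finRotate_zero]
      ext
      simp
    · have := iterate_minimalPeriod (f := finRotate l) (x := 0)
      rw [iterate_finRotate_zero, Fin.ext_iff] at this
      exact Nat.dvd_of_mod_eq_zero (by simpa using this)
  have hi : (finRotate l)^[(i : ℕ)] 0 = i := by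
    rw [iterate_finRotate_zero]
    ext
    simp
  rw [← hi, minimalPeriod_apply_iterate, h0]
  rw [← minimalPeriod_pos_iff_mem_periodicPts, h0]
  exact NeZero.pos l

theorem minimalPeriod_sumMap_inl {Y Z : Type*} (τ : Y → Y) (ρ : Z → Z) (y : Y) :
    minimalPeriod (Sum.map τ ρ) (Sum.inl y) = minimalPeriod τ y :=
  minimalPeriod_eq_minimalPeriod_iff.2 fun n => by
    rw [IsPeriodicPt, IsFixedPt, iterate_sumMap_inl, Sum.inl.injEq]
    rfl

theorem minimalPeriod_sumMap_inr {Y Z : Type*} (τ : Y → Y) (ρ : Z → Z) (z : Z) :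
    minimalPeriod (Sum.map τ ρ) (Sum.inr z) = minimalPeriod ρ z :=
  minimalPeriod_eq_minimalPeriod_iff.2 fun n => by
    rw [IsPeriodicPt, IsFixedPt, iterate_sumMap_inr, Sum.inr.injEq]
    rfl

theorem card_admissiblePair_isEmpty {X A : Type*} [IsEmpty X] [LinearOrder A] (τ : X → X) :
    Nat.card (AdmissiblePair A τ) = 1 := by
  rw [Nat.card_eq_one_iff_unique]
  constructor
  · refine ⟨fun q q' => Subtype.ext (Prod.ext ?_ ?_)⟩
    · exact Subsingleton.elim _ _
    · exact Subsingleton.elim _ _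
  · exact ⟨⟨(isEmptyElim, isEmptyElim), ⟨isEmptyElim, fun {x} => isEmptyElim x,
      fun {x} => isEmptyElim x, fun {x} => isEmptyElim x, fun {x} => isEmptyElim x⟩⟩⟩

/-- The number of multisets of primitive necklaces over `a` letters with lengths `L`, multiplied by
the order of the centralizer of a permutation with cycle lengths `L`. -/
noncomputable def necklaceCount (a : ℕ) : List ℕ → ℕ
  | [] => 1
  | l :: L => necklaceCount a L * (primCount a l + l * L.count l)

/-- The count of points of each period is carried through the induction because it enters the factor
of the next cycle. -/
theorem exists_perm_card_admissiblePair (L : List ℕ) (hL : ∀ l ∈ L, 0 < l) :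
    ∃ (X : Type) (_ : Fintype X) (_ : DecidableEq X) (τ : Equiv.Perm X),
      τ.partition.parts = L ∧ (∀ l, Nat.card {x // minimalPeriod τ x = l} = l * L.count l) ∧
      ∀ a, Nat.card (AdmissiblePair (Fin a) τ) = necklaceCount a L := by
  induction L with
  | nil =>
    refine ⟨Empty, inferInstance, inferInstance, 1, ?_, fun l => by simp, fun a => ?_⟩
    · simp [parts_partition]
    · rw [card_admissiblePair_isEmpty, necklaceCount]
  | cons l L ih =>
    obtain ⟨X, _, _, τ, hparts, hper, hcount⟩ := ih fun l' hl' => hL l' (List.mem_cons_of_mem l hl')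
    have hl : 0 < l := hL l List.mem_cons_self
    have : NeZero l := ⟨hl.ne'⟩
    refine ⟨X ⊕ Fin l, inferInstance, inferInstance, Equiv.Perm.sumCongr τ (finRotate l), ?_, ?_, ?_⟩
    · rw [parts_partition_sumCongr, hparts, parts_partition_finRotate hl, add_comm]
      rfl
    · intro k
      have e : {x // minimalPeriod (Equiv.Perm.sumCongr τ (finRotate l)) x = k} ≃
          {x // minimalPeriod τ x = k} ⊕ {i : Fin l // minimalPeriod (finRotate l) i = k} := by
        refine Equiv.subtypeSum.trans (Equiv.sumCongr (Equiv.subtypeEquivRight fun x => ?_)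
          (Equiv.subtypeEquivRight fun x => ?_))
        · rw [coe_permSumCongr, minimalPeriod_sumMap_inl]
        · rw [coe_permSumCongr, minimalPeriod_sumMap_inr]
      rw [Nat.card_congr e, Nat.card_sum, hper, List.count_cons]
      simp only [minimalPeriod_finRotate]
      by_cases hk : l = k
      · subst hk
        simp
        ring
      · have : IsEmpty {i : Fin l // l = k} := ⟨fun i => hk i.2⟩
        simp [hk]
    · intro a
      have hmp := minimalPeriod_finRotate (0 : Fin l)
      have := finite_minimalPeriod_seqShift (Fin a) (l := minimalPeriod (finRotate l) 0)
        (by rw [hmp]; exact hl)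
      rw [coe_permSumCongr, card_admissiblePair_sumMap (z₀ := (0 : Fin l)), hmp, hper, hcount,
        necklaceCount, primCount]
      · intro z
        refine ⟨z, ?_⟩
        rw [iterate_finRotate_zero]
        ext
        simp
      · rw [hmp]
        exact hl
      · intro y
        exact minimalPeriod_pos_of_mem_periodicPts
          (mem_periodicPts.2 ⟨orderOf τ, orderOf_pos τ, by
            rw [IsPeriodicPt, IsFixedPt, Equiv.Perm.iterate_eq_pow, pow_orderOf_eq_one]
            rfl⟩)

end CycleModel

/-! ### Compatible pairs counted by descents -/

section DescentCount

/-- A word `c` is compatible with `π` if it increases weakly, and strictly at the descents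
of `π`. -/
def IsCompatibleWord {n a : ℕ} (π : Equiv.Perm (Fin n)) (c : Fin n → Fin a) : Prop :=
  StrictMono fun i => toLex (c i, π i)

theorem isCompatibleWord_iff {n a : ℕ} {π : Equiv.Perm (Fin n)} {c : Fin n → Fin a} :
    IsCompatibleWord π c ↔ ∀ i j, i < j → c i < c j ∨ c i = c j ∧ π i < π j := by
  simp only [IsCompatibleWord, StrictMono, Prod.Lex.toLex_lt_toLex]

section Sorting

variable {X : Type*} [Fintype X] {n a : ℕ} (τ : Equiv.Perm X)

/-- Transport of a word on positions to a colouring and an order of `X`. -/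
def sortedPair (q : Σ σ : X ≃ Fin n, {c : Fin n → Fin a // IsCompatibleWord (σ.permCongr τ) c}) :
    AdmissiblePair (Fin a) τ :=
  ⟨(fun x => q.2.1 (q.1 x), fun x y => q.1 x < q.1 y), by
    obtain ⟨σ, c, hc⟩ := q
    rw [isCompatibleWord_iff] at hc
    refine ⟨fun x => lt_irrefl _, fun h h' => lt_trans h h', fun {x y} hne => ?_,
      fun {x y} h => ?_, fun {x y} h he => ?_⟩
    · exact lt_or_gt_of_ne fun he => hne (σ.injective he)
    · rcases hc _ _ h with h1 | h1
      · exact h1.le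
      · exact h1.1.le
    · rcases hc _ _ h with h1 | h1
      · exact absurd he h1.ne
      · simpa using h1.2⟩

/-- Ranking `X` by `r` recovers the numbering, which is unique because `Fin n` has no nontrivial
order automorphism. -/
theorem sortedPair_bijective (hX : Fintype.card X = n) :
    Bijective (sortedPair (n := n) (a := a) τ) := by
  constructor
  · rintro ⟨σ, c, hc⟩ ⟨σ', c', hc'⟩ he
    have he := Subtype.ext_iff.1 he
    have h1 : ∀ x, c (σ x) = c' (σ' x) := fun x => congrFun (congrArg Prod.fst he) x
    have h2 : ∀ x y, σ x < σ y ↔ σ' x < σ' y := fun x y =>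
      iff_of_eq (congrFun (congrFun (congrArg Prod.snd he) x) y)
    have h3 : σ = σ' := by
      let e : Fin n ≃o Fin n := ⟨σ.symm.trans σ', fun {i j} => by
        rw [← not_lt, ← not_lt, not_iff_not]
        simp [← h2]⟩
      ext x
      have : e (σ x) = OrderIso.refl _ (σ x) := by rw [Subsingleton.elim e (OrderIso.refl _)]
      have h4 : σ' x = σ x := by simpa [e] using this
      rw [h4]
    subst h3
    obtain rfl : c = c' := funext fun i => by simpa using h1 (σ.symm i)
    rfl
  · rintro ⟨⟨f, r⟩, h⟩
    have hlt : ∀ x, relRank r x < n := by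
      intro x
      rw [← hX, ← Nat.card_eq_fintype_card, ← Set.ncard_univ]
      refine Set.ncard_lt_ncard ⟨Set.subset_univ _, fun hs => ?_⟩ (Set.toFinite _)
      exact h.irrefl x (hs (Set.mem_univ x))
    let σ : X ≃ Fin n := Equiv.ofBijective (fun x => ⟨relRank r x, hlt x⟩)
      ((Fintype.bijective_iff_injective_and_card _).2
        ⟨fun x y hxy => h.relRank_inj (Fin.ext_iff.1 hxy), by simpa using hX⟩)
    have hσ : ∀ x y, σ x < σ y ↔ r x y := fun x y => h.relRank_lt_iff
    refine ⟨⟨σ, fun i => f (σ.symm i), ?_⟩, Subtype.ext (Prod.ext ?_ ?_)⟩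
    · rw [isCompatibleWord_iff]
      intro i j hij
      have hr : r (σ.symm i) (σ.symm j) := by
        rw [← hσ]
        simpa using hij
      rcases (h.mono hr).lt_or_eq with h1 | h1
      · exact Or.inl h1
      · refine Or.inr ⟨h1, ?_⟩
        rw [Equiv.permCongr_apply, Equiv.permCongr_apply, hσ]
        exact h.step hr h1
    · funext x
      simp [sortedPair]
    · funext x y
      simp only [sortedPair]
      exact propext (hσ x y)

theorem card_admissiblePair_eq_sum [DecidableEq X] (hX : Fintype.card X = n) :
    Nat.card (AdmissiblePair (Fin a) τ) = ∑ σ : X ≃ Fin n,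
      Nat.card {c : Fin n → Fin a // IsCompatibleWord (σ.permCongr τ) c} := by
  rw [← Nat.card_congr (Equiv.ofBijective _ (sortedPair_bijective τ hX)), Nat.card_sigma]

end Sorting

theorem card_strictMono (n N : ℕ) : Nat.card {e : Fin n → Fin N // StrictMono e} = N.choose n := by
  have e : {e : Fin n → Fin N // StrictMono e} ≃ (Fin n ↪o Fin N) :=
    ⟨fun e => OrderEmbedding.ofStrictMono e.1 e.2, fun e => ⟨e, e.strictMono⟩,
      fun _ => rfl, fun _ => by ext; rfl⟩
  rw [Nat.card_congr e, Nat.card_congr Set.powersetCard.ofFinEmbEquiv, Set.powersetCard.card]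
  simp

variable {m a : ℕ} (π : Equiv.Perm (Fin (m + 1)))

/-- The number of non-descents of `π` before the position `i`. -/
def ascentsBefore (i : Fin (m + 1)) : ℕ :=
  (Finset.univ.filter fun k => k < i ∧ k ∉ descentSet π).card

theorem castSucc_mem_descentSet_iff (i : Fin m) :
    i.castSucc ∈ descentSet π ↔ π i.succ < π i.castSucc := by
  simp only [descentSet, Finset.mem_filter, Finset.mem_univ, true_and]
  refine ⟨fun ⟨_, h⟩ => h, fun h => ⟨by simp, h⟩⟩

theorem last_notMem_descentSet : Fin.last m ∉ descentSet π := by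
  simp [descentSet]

theorem ascentsBefore_succ (i : Fin m) : ascentsBefore π i.succ =
    ascentsBefore π i.castSucc + if i.castSucc ∈ descentSet π then 0 else 1 := by
  have h : (Finset.univ.filter fun k => k < i.succ ∧ k ∉ descentSet π) =
      (Finset.univ.filter fun k => k < i.castSucc ∧ k ∉ descentSet π) ∪
        ({i.castSucc} : Finset (Fin (m + 1))).filter fun k => k ∉ descentSet π := by
    ext k
    simp only [Finset.mem_filter, Finset.mem_univ, true_and, Finset.mem_union,
      Finset.mem_singleton, ← or_and_right, Fin.lt_def, Fin.ext_iff, Fin.val_succ,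
      Fin.val_castSucc]
    rw [Nat.lt_succ_iff_lt_or_eq]
  rw [ascentsBefore, h, Finset.card_union_of_disjoint, ascentsBefore, Finset.filter_singleton]
  · split_ifs <;> simp_all
  · rw [Finset.disjoint_left]
    intro k hk hk'
    simp only [Finset.mem_filter, Finset.mem_singleton] at hk hk'
    exact absurd hk.2.1 (by rw [hk'.1]; exact lt_irrefl _)

theorem ascentsBefore_zero : ascentsBefore π 0 = 0 := by
  simp [ascentsBefore]

theorem ascentsBefore_last : ascentsBefore π (Fin.last m) + descentNumber π = m := by
  have h : (Finset.univ.filter fun k => k < Fin.last m ∧ k ∉ descentSet π) =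
      (descentSet π)ᶜ.erase (Fin.last m) := by
    ext k
    simp [Fin.lt_last_iff_ne_last]
  have h2 : (descentSet π).card ≤ m + 1 := by simpa using (descentSet π).card_le_univ
  have h3 := Finset.card_compl (descentSet π)
  rw [Fintype.card_fin] at h3
  rw [ascentsBefore, h, Finset.card_erase_of_mem (by simpa using last_notMem_descentSet π),
    descentNumber]
  have h4 : 0 < (descentSet π)ᶜ.card :=
    Finset.card_pos.2 ⟨Fin.last m, by simpa using last_notMem_descentSet π⟩
  omega

/-- The shift grows by one exactly at ascents, where the word may stay constant, and not at
descents, where it must already rise. -/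
theorem isCompatibleWord_iff_strictMono {c : Fin (m + 1) → Fin a} :
    IsCompatibleWord π c ↔ StrictMono fun i => (c i : ℕ) + ascentsBefore π i := by
  rw [IsCompatibleWord, Fin.strictMono_iff_lt_succ, Fin.strictMono_iff_lt_succ]
  refine forall_congr' fun i => ?_
  have hne : π i.castSucc ≠ π i.succ := fun h => by
    have := π.injective h
    simp [Fin.ext_iff] at this
  rw [Prod.Lex.toLex_lt_toLex, ascentsBefore_succ]
  simp only [castSucc_mem_descentSet_iff, Fin.lt_def, Fin.ext_iff, ne_eq] at hne ⊢
  split_ifs <;> omega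

theorem card_isCompatibleWord : Nat.card {c : Fin (m + 1) → Fin a // IsCompatibleWord π c} =
    (a + m - descentNumber π).choose (m + 1) := by
  rw [← card_strictMono]
  have hlast := ascentsBefore_last π
  have hmono : Monotone (ascentsBefore π) := by
    rw [Fin.monotone_iff_le_succ]
    intro i
    rw [ascentsBefore_succ]
    omega
  have hle : ∀ i, ascentsBefore π i ≤ ascentsBefore π (Fin.last m) := fun i =>
    hmono (Fin.le_last i)
  refine Nat.card_congr ⟨fun c => ⟨fun i => ⟨(c.1 i : ℕ) + ascentsBefore π i, ?_⟩, ?_⟩,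
    fun e => ⟨fun i => ⟨(e.1 i : ℕ) - ascentsBefore π i, ?_⟩, ?_⟩, ?_, ?_⟩
  · have := (c.1 i).2
    have := hle i
    omega
  · exact (isCompatibleWord_iff_strictMono π).1 c.2
  -- The inverse subtracts the shift: a strictly increasing sequence minus the shift is weakly
  -- increasing, hence nonnegative from position `0` on, and below `a` because the total shift is `m
  -- - d`.
  all_goals
    have hdiff : ∀ e : Fin (m + 1) → Fin (a + m - descentNumber π), StrictMono e →
        Monotone fun i => ((e i : ℕ) : ℤ) - ascentsBefore π i := by
      intro e he
      rw [Fin.monotone_iff_le_succ]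
      intro i
      have h1 : e i.castSucc < e i.succ := he (Fin.castSucc_lt_succ)
      rw [Fin.lt_def] at h1
      rw [ascentsBefore_succ]
      split_ifs <;> push_cast <;> omega
    have hge : ∀ e : Fin (m + 1) → Fin (a + m - descentNumber π), StrictMono e →
        ∀ i, ascentsBefore π i ≤ e i := by
      intro e he i
      have := hdiff e he (Fin.zero_le i)
      simp only [ascentsBefore_zero] at this
      omega
  · have h1 := hge _ e.2 i
    have h2 := hdiff _ e.2 (Fin.le_last i)
    have h3 := (e.1 (Fin.last m)).2
    simp only at h2
    omega
  · rw [isCompatibleWord_iff_strictMono]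
    intro i j hij
    have h1 := hge _ e.2 i
    have h2 := hge _ e.2 j
    have h3 := e.2 hij
    rw [Fin.lt_def] at h3
    simp only
    omega
  · intro c
    ext i
    simp
  · intro e
    ext i
    simpa using Nat.sub_add_cancel (hge _ e.2 i)

end DescentCount

end Combinatorics

open MeasureTheory Filter Topology

/-! ### Averages over a conjugacy class -/

section ClassAverage

variable {n : ℕ}

theorem mem_cycleClass_iff_isConj {p : n.Partition} {τ π : Equiv.Perm (Fin n)}
    (hτ : τ ∈ cycleClass p) : π ∈ cycleClass p ↔ IsConj τ π := by
  have hτ' : τ.partition.parts = p.parts := hτ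
  change π.partition.parts = p.parts ↔ _
  rw [← hτ', Equiv.Perm.partition_eq_of_isConj, Nat.Partition.ext_iff, eq_comm]

theorem uniformClass_real_singleton (p : n.Partition) [DecidablePred (· ∈ cycleClass p)]
    (π : Equiv.Perm (Fin n)) : (uniformClass p).real {π} =
      if π ∈ cycleClass p then ((Finset.univ.filter (· ∈ cycleClass p)).card : ℝ)⁻¹ else 0 := by
  have h : cycleClass p = ((Finset.univ.filter (· ∈ cycleClass p) : Finset _) : Set _) := by simp
  have h2 : uniformClass p {π} = (((Finset.univ.filter (· ∈ cycleClass p)) ∩ {π}).card : ENNReal) /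
      (Finset.univ.filter (· ∈ cycleClass p)).card := by
    rw [← ProbabilityTheory.uniformOn_apply_finset, ← h, uniformClass, Finset.coe_singleton]
  rw [Measure.real, h2]
  split_ifs with hπ
  · rw [Finset.inter_singleton_of_mem (by simpa using hπ)]
    simp
  · rw [Finset.inter_singleton_of_notMem (by simpa using hπ)]
    simp

/-- All fibres of `ρ ↦ ρ τ ρ⁻¹` over the class are equinumerous with the centralizer of `τ`. -/
theorem sum_conj_eq_factorial_mul_integral {p : n.Partition} {τ : Equiv.Perm (Fin n)}
    (hτ : τ ∈ cycleClass p) (g : Equiv.Perm (Fin n) → ℂ) :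
    ∑ ρ : Equiv.Perm (Fin n), g (ρ * τ * ρ⁻¹) = n.factorial * ∫ π, g π ∂(uniformClass p) := by
  classical
  set K := (Finset.univ.filter fun ρ : Equiv.Perm (Fin n) => ρ * τ * ρ⁻¹ = τ).card with hK
  set C := Finset.univ.filter (· ∈ cycleClass p) with hC
  have hfib : ∀ π ∈ C,
      (Finset.univ.filter fun ρ : Equiv.Perm (Fin n) => ρ * τ * ρ⁻¹ = π).card = K := by
    intro π hπ
    obtain ⟨σ, hσ⟩ := isConj_iff.1 ((mem_cycleClass_iff_isConj hτ).1 (Finset.mem_filter.1 hπ).2)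
    symm
    refine Finset.card_equiv (Equiv.mulLeft σ) fun ρ => ?_
    simp only [Finset.mem_filter, Finset.mem_univ, true_and, Equiv.coe_mulLeft, mul_inv_rev]
    rw [← hσ, show σ * ρ * τ * (ρ⁻¹ * σ⁻¹) = σ * (ρ * τ * ρ⁻¹) * σ⁻¹ by group, mul_left_inj,
      mul_right_inj]
  have hmaps : ∀ ρ ∈ (Finset.univ : Finset (Equiv.Perm (Fin n))), ρ * τ * ρ⁻¹ ∈ C := by
    intro ρ _
    rw [hC, Finset.mem_filter, mem_cycleClass_iff_isConj hτ]
    exact ⟨Finset.mem_univ _, isConj_iff.2 ⟨ρ, rfl⟩⟩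
  have hsum : ∀ g : Equiv.Perm (Fin n) → ℂ,
      ∑ ρ : Equiv.Perm (Fin n), g (ρ * τ * ρ⁻¹) = K * ∑ π ∈ C, g π := by
    intro g
    rw [← Finset.sum_fiberwise_of_maps_to hmaps, Finset.mul_sum]
    refine Finset.sum_congr rfl fun π hπ => ?_
    rw [Finset.sum_congr rfl (g := fun _ => g π) fun ρ hρ => by rw [(Finset.mem_filter.1 hρ).2],
      Finset.sum_const, hfib π hπ, nsmul_eq_mul]
  have hone : (n.factorial : ℂ) = K * C.card := by
    simpa [Fintype.card_perm] using hsum fun _ => 1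
  have hC0 : (C.card : ℂ) ≠ 0 := by
    rw [Nat.cast_ne_zero]
    exact Finset.card_ne_zero_of_mem (a := τ) (by simpa [hC] using hτ)
  rw [integral_fintype .of_finite, hsum, hone]
  simp only [uniformClass_real_singleton, ite_smul, zero_smul]
  rw [← Finset.sum_filter, ← hC, ← Finset.smul_sum, Complex.real_smul]
  push_cast
  field_simp

end ClassAverage

/-! ### The polynomial identity -/

section Identity

open Polynomial

/-- The polynomial whose value at `a` is `necklaceCount a L`. -/
noncomputable def necklacePoly : List ℕ → ℂ[X]
  | [] => 1
  | l :: L => necklacePoly L * (primPoly l + C ((l : ℂ) * L.count l))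

theorem eval_necklacePoly_natCast (a : ℕ) (L : List ℕ) (hL : ∀ l ∈ L, 0 < l) :
    (necklacePoly L).eval (a : ℂ) = necklaceCount a L := by
  induction L with
  | nil => simp [necklacePoly, necklaceCount]
  | cons l L ih =>
    rw [necklacePoly, necklaceCount, eval_mul, eval_add, eval_C,
      ih fun l' hl' => hL l' (List.mem_cons_of_mem l hl'),
      eval_primPoly_natCast a (hL l List.mem_cons_self)]
    push_cast
    ring

theorem descentNumber_le {m : ℕ} (π : Equiv.Perm (Fin (m + 1))) : descentNumber π ≤ m := by
  have := ascentsBefore_last π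
  omega

theorem factorial_mul_choose_eq_prod {m d : ℕ} (hd : d ≤ m) (a : ℕ) :
    ((m + 1).factorial : ℂ) * ((a + m - d).choose (m + 1) : ℕ) =
      ∏ k ∈ Finset.range (m + 1), ((a : ℂ) + (k - d)) := by
  rw [← Nat.cast_mul, ← Nat.descFactorial_eq_factorial_mul_choose,
    ← descPochhammer_eval_eq_descFactorial, descPochhammer_eval_eq_prod_range,
    ← Finset.prod_range_reflect]
  refine Finset.prod_congr rfl fun k hk => ?_
  have hk : k ≤ m := by simpa [Nat.lt_succ_iff] using hk
  rw [Nat.cast_sub (by omega), show m + 1 - 1 - k = m - k by omega, Nat.cast_sub hk]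
  push_cast
  ring

theorem parts_partition_permCongr {X : Type*} [Fintype X] [DecidableEq X] {n : ℕ}
    (e : X ≃ Fin n) (τ : Equiv.Perm X) :
    (e.permCongr τ).partition.parts = τ.partition.parts := by
  have h : e.permCongr τ = τ.extendDomain (p := fun _ : Fin n => True)
      (e.trans (Equiv.subtypeUnivEquiv fun _ => trivial).symm) := by
    ext i
    have := Equiv.Perm.extendDomain_apply_image τ (p := fun _ : Fin n => True)
      (e.trans (Equiv.subtypeUnivEquiv fun _ => trivial).symm) (e.symm i)
    simp only [Equiv.trans_apply, Equiv.subtypeUnivEquiv, Equiv.coe_fn_symm_mk,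
      Equiv.apply_symm_apply] at this
    rw [Equiv.permCongr_apply]
    exact congrArg Fin.val this.symm
  have hc : (e.permCongr τ).cycleType = τ.cycleType := by
    rw [h, Equiv.Perm.cycleType_extendDomain]
  rw [Equiv.Perm.parts_partition, Equiv.Perm.parts_partition, ← Equiv.Perm.sum_cycleType,
    ← Equiv.Perm.sum_cycleType, hc, Fintype.card_congr e]

/-- The generating identity for descents over a conjugacy class. -/
theorem integral_prod_eq_eval_necklacePoly {n : ℕ} (p : n.Partition) (L : List ℕ)
    (hL : (L : Multiset ℕ) = p.parts) (z : ℂ) :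
    ∫ π, ∏ k ∈ Finset.range n, (z + ((k : ℂ) - descentNumber π)) ∂(uniformClass p) =
      (necklacePoly L).eval z := by
  have hpos : ∀ l ∈ L, 0 < l := fun l hl => p.parts_pos (by rw [← hL]; exact hl)
  obtain _ | m := n
  · have hnil : L = [] := by
      have h0 := p.parts_sum
      rw [← hL] at h0
      rcases L with _ | ⟨l, L⟩
      · rfl
      · have := hpos l List.mem_cons_self
        simp at h0
        omega
    subst hnil
    simp [necklacePoly]
  obtain ⟨Ω, _, _, τ, hparts, -, hcount⟩ := exists_perm_card_admissiblePair L hpos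
  have hX : Fintype.card Ω = m + 1 := by
    rw [← τ.partition.parts_sum, hparts, hL, p.parts_sum]
  let e : Ω ≃ Fin (m + 1) := Fintype.equivFinOfCardEq hX
  set τ' := e.permCongr τ with hτ'
  have hmem : τ' ∈ cycleClass p := by
    change τ'.partition.parts = p.parts
    rw [hτ', parts_partition_permCongr, hparts, hL]
  have hnat : ∀ a : ℕ, ∑ ρ : Equiv.Perm (Fin (m + 1)), ∏ k ∈ Finset.range (m + 1),
      ((a : ℂ) + ((k : ℂ) - descentNumber (ρ * τ' * ρ⁻¹))) =
        (m + 1).factorial * necklaceCount a L := by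
    intro a
    rw [← hcount, card_admissiblePair_eq_sum τ hX, Nat.cast_sum, Finset.mul_sum]
    refine Fintype.sum_equiv
      ⟨fun ρ => e.trans ρ, fun σ => e.symm.trans σ, fun ρ => by ext; simp, fun σ => by ext; simp⟩
      _ _ fun ρ => ?_
    have hconj : (e.trans ρ).permCongr τ = ρ * τ' * ρ⁻¹ := by
      ext i
      simp [hτ', Equiv.permCongr_apply, Equiv.Perm.mul_apply, Equiv.Perm.inv_def]
    simp only [Equiv.coe_fn_mk]
    rw [hconj, card_isCompatibleWord, factorial_mul_choose_eq_prod (descentNumber_le _)]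
  have hpoly : (∑ ρ : Equiv.Perm (Fin (m + 1)), ∏ k ∈ Finset.range (m + 1),
      (X + C ((k : ℂ) - descentNumber (ρ * τ' * ρ⁻¹)))) =
        C ((m + 1).factorial : ℂ) * necklacePoly L := by
    -- The counting identity is known at every natural `a`, which is enough for two polynomials.
    refine Polynomial.eq_of_infinite_eval_eq _ _
      ((Set.infinite_range_of_injective (Nat.cast_injective (R := ℂ))).mono ?_)
    rintro _ ⟨a, rfl⟩
    change eval _ _ = eval _ _
    rw [eval_mul, eval_C, eval_necklacePoly_natCast a L hpos, ← hnat, eval_finsetSum]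
    refine Finset.sum_congr rfl fun ρ _ => ?_
    simp [eval_prod]
  have h1 := congrArg (eval z) hpoly
  rw [eval_mul, eval_C, eval_finsetSum] at h1
  have h2 := sum_conj_eq_factorial_mul_integral hmem
    (fun π => ∏ k ∈ Finset.range (m + 1), (z + ((k : ℂ) - descentNumber π)))
  have h3 : ((m + 1).factorial : ℂ) ≠ 0 := Nat.cast_ne_zero.2 (Nat.factorial_ne_zero _)
  refine mul_left_cancel₀ h3 (h2.symm.trans (Eq.trans ?_ h1))
  refine Finset.sum_congr rfl fun ρ _ => ?_
  simp only [eval_prod, eval_add, eval_X, eval_C]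

end Identity

/-! ### Second-order expansion of products -/

section Expansion

theorem norm_log_one_add_sub_le {w : ℂ} (hw : ‖w‖ ≤ 1 / 2) :
    ‖Complex.log (1 + w) - (w - w ^ 2 / 2)‖ ≤ ‖w‖ ^ 3 := by
  have h := Complex.norm_log_sub_logTaylor_le 2 (z := w) (by linarith)
  have h2 : Complex.logTaylor (2 + 1) w = w - w ^ 2 / 2 := by
    simp [Complex.logTaylor_succ, Complex.logTaylor_zero]
    ring
  rw [h2] at h
  refine h.trans ?_
  have h3 : (1 - ‖w‖)⁻¹ ≤ 2 := by
    rw [inv_le_comm₀ (by linarith) (by norm_num)]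
    linarith
  have h4 : 0 ≤ ‖w‖ ^ 3 := by positivity
  norm_num
  nlinarith [mul_le_mul_of_nonneg_left h3 h4]

theorem exists_prod_one_add_mul_eq_exp (N : ℕ) (x : ℕ → ℂ) {B : ℝ} {u : ℂ}
    (hx : ∀ k < N, ‖x k‖ ≤ B) (hB : B * ‖u‖ ≤ 1 / 2) :
    ∃ ε : ℂ, ‖ε‖ ≤ N * (B * ‖u‖) ^ 3 ∧ ∏ k ∈ Finset.range N, (1 + x k * u) =
      Complex.exp (u * ∑ k ∈ Finset.range N, x k -
        u ^ 2 / 2 * ∑ k ∈ Finset.range N, x k ^ 2 + ε) := by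
  have hle : ∀ k < N, ‖x k * u‖ ≤ B * ‖u‖ := fun k hk => by
    rw [norm_mul]
    exact mul_le_mul_of_nonneg_right (hx k hk) (norm_nonneg u)
  refine ⟨∑ k ∈ Finset.range N,
    (Complex.log (1 + x k * u) - (x k * u - (x k * u) ^ 2 / 2)), ?_, ?_⟩
  · refine (norm_sum_le _ _).trans ((Finset.sum_le_card_nsmul _ _ ((B * ‖u‖) ^ 3) ?_).trans ?_)
    · intro k hk
      have hk := hle k (Finset.mem_range.1 hk)
      exact (norm_log_one_add_sub_le (hk.trans hB)).trans
        (pow_le_pow_left₀ (norm_nonneg _) hk 3)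
    · simp
  · have h1 : u * ∑ k ∈ Finset.range N, x k - u ^ 2 / 2 * ∑ k ∈ Finset.range N, x k ^ 2 +
        ∑ k ∈ Finset.range N, (Complex.log (1 + x k * u) - (x k * u - (x k * u) ^ 2 / 2)) =
        ∑ k ∈ Finset.range N, Complex.log (1 + x k * u) := by
      rw [Finset.mul_sum, Finset.mul_sum, ← Finset.sum_sub_distrib, ← Finset.sum_add_distrib]
      exact Finset.sum_congr rfl fun k _ => by ring
    rw [h1, Complex.exp_sum]
    refine Finset.prod_congr rfl fun k hk => (Complex.exp_log fun h0 => ?_).symm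
    have hk := (hle k (Finset.mem_range.1 hk)).trans hB
    rw [eq_neg_of_add_eq_zero_right h0] at hk
    norm_num at hk

theorem sum_range_sub (n : ℕ) (d : ℂ) :
    ∑ k ∈ Finset.range n, ((k : ℂ) - d) = n * ((n - 1) / 2 - d) := by
  induction n with
  | zero => simp
  | succ n ih =>
    rw [Finset.sum_range_succ, ih]
    push_cast
    ring

theorem sum_range_sub_sq (n : ℕ) (d : ℂ) :
    ∑ k ∈ Finset.range n, ((k : ℂ) - d) ^ 2 =
      n * ((n - 1) / 2 - d) ^ 2 + n * (n ^ 2 - 1) / 12 := by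
  induction n with
  | zero => simp
  | succ n ih =>
    rw [Finset.sum_range_succ, ih]
    push_cast
    ring

end Expansion

/-! ### Asymptotics of the cycle factors -/

section NecklaceAsymptotics

open Polynomial

/-- The divisor pair `(1, l)` contributes exactly `1`. Any other, with second entry `y < l`, leaves
`± u ^ (l - y)` or `0`, and there are at most `l` of them. -/
theorem norm_eval_primPoly_mul_pow_sub_one_le {l : ℕ} (hl : 0 < l) {z u : ℂ} (hzu : z * u = 1)
    (hu : ‖u‖ ≤ 1) : ‖(primPoly l).eval z * u ^ l - 1‖ ≤ l * ‖u‖ := by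
  have hmem : (1, l) ∈ l.divisorsAntidiagonal := by simp [hl.ne']
  have h1 : (primPoly l).eval z * u ^ l - 1 = ∑ q ∈ l.divisorsAntidiagonal.erase (1, l),
      (ArithmeticFunction.moebius q.1 : ℂ) * (z ^ q.2 * u ^ l) := by
    rw [primPoly, eval_finsetSum, ← Finset.add_sum_erase _ _ hmem, add_mul, Finset.sum_mul]
    simp only [ArithmeticFunction.moebius_apply_one, Int.cast_one, eval_smul, eval_pow, eval_X,
      smul_eq_mul, one_mul, mul_assoc]
    rw [← mul_pow, hzu]
    ring
  rw [h1]
  refine (norm_sum_le _ _).trans ((Finset.sum_le_card_nsmul _ _ ‖u‖ ?_).trans ?_)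
  · rintro ⟨x, y⟩ hq
    simp only [Finset.mem_erase, Nat.mem_divisorsAntidiagonal, ne_eq, Prod.mk.injEq] at hq
    obtain ⟨hne, hxy, -⟩ := hq
    have hy : y < l := by
      have hx1 : x ≠ 1 := by
        rintro rfl
        exact hne ⟨rfl, by omega⟩
      have hx0 : x ≠ 0 := by
        rintro rfl
        omega
      have hy0 : 0 < y := by
        rcases Nat.eq_zero_or_pos y with rfl | h
        · omega
        · exact h
      nlinarith [show 2 ≤ x by omega]
    obtain ⟨t, rfl⟩ := Nat.exists_eq_add_of_lt hy
    rw [show z ^ y * u ^ (y + t + 1) = u * u ^ t by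
      rw [add_assoc, pow_add, ← mul_assoc, ← mul_pow, hzu]; ring, norm_mul, norm_mul, norm_pow]
    have hmu : ‖((ArithmeticFunction.moebius x : ℤ) : ℂ)‖ ≤ 1 := by
      rw [Complex.norm_intCast]
      exact_mod_cast ArithmeticFunction.abs_moebius_le_one
    calc _ ≤ 1 * (‖u‖ * 1) := by
          gcongr
          exact pow_le_one₀ (norm_nonneg u) hu
      _ = ‖u‖ := by ring
  · rw [nsmul_eq_mul]
    refine mul_le_mul_of_nonneg_right (Nat.cast_le.2 ((Finset.card_erase_le).trans ?_))
      (norm_nonneg u)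
    rw [← Nat.map_div_right_divisors, Finset.card_map]
    exact Nat.card_divisors_le_self l

theorem primPoly_one : primPoly 1 = X := by
  simp [primPoly]

theorem eval_necklacePoly_replicate_one {z u : ℂ} (hzu : z * u = 1) (m : ℕ) :
    (necklacePoly (List.replicate m 1)).eval z * u ^ m =
      ∏ j ∈ Finset.range m, (1 + (j : ℂ) * u) := by
  induction m with
  | zero => simp [necklacePoly]
  | succ m ih =>
    rw [List.replicate_succ, necklacePoly, Finset.prod_range_succ, ← ih, primPoly_one]
    simp only [eval_mul, eval_add, eval_X, eval_C, List.count_replicate_self]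
    rw [show eval z (necklacePoly (List.replicate m 1)) * (z + ((1 : ℕ) : ℂ) * m) * u ^ (m + 1) =
      eval z (necklacePoly (List.replicate m 1)) * u ^ m * (z * u + m * u) by push_cast; ring, hzu]

/-- Each cycle of length `l ≥ 2` has normalized factor `1 + O(l (‖u‖ + N ‖u‖²))`: the multiplicity
term carries `u ^ l`, which is at most `‖u‖²` in modulus. For `l = 1` it would be of order `N ‖u‖`
per cycle, so the fixed points are kept apart in `R`. -/
theorem exists_eval_necklacePoly_append {z u : ℂ} (hzu : z * u = 1) (hu : ‖u‖ ≤ 1) (L R : List ℕ)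
    (hL : ∀ l ∈ L, 2 ≤ l) {N : ℕ} (hN : (L ++ R).length ≤ N) :
    ∃ q : ℂ, ‖q - 1‖ ≤ Real.exp (L.sum * (‖u‖ + N * ‖u‖ ^ 2)) - 1 ∧
      (necklacePoly (L ++ R)).eval z * u ^ (L ++ R).sum =
        (necklacePoly R).eval z * u ^ R.sum * q := by
  induction L with
  | nil => exact ⟨1, by simp, by simp⟩
  | cons l L ih =>
    have hlen : (L ++ R).length ≤ N := by
      simp only [List.cons_append, List.length_cons] at hN
      omega
    obtain ⟨q, hq, he⟩ := ih (fun l' hl' => hL l' (List.mem_cons_of_mem l hl')) hlen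
    have hl := hL l List.mem_cons_self
    set η : ℂ := (primPoly l).eval z * u ^ l - 1 + l * (L ++ R).count l * u ^ l with hη
    have hηle : ‖η‖ ≤ l * (‖u‖ + N * ‖u‖ ^ 2) := by
      have h1 := norm_eval_primPoly_mul_pow_sub_one_le (show 0 < l by omega) hzu hu
      have h2 : ‖(l : ℂ) * (L ++ R).count l * u ^ l‖ ≤ l * (N * ‖u‖ ^ 2) := by
        rw [norm_mul, norm_mul, norm_pow, Complex.norm_natCast, Complex.norm_natCast, mul_assoc]
        have hcnt : ((L ++ R).count l : ℝ) ≤ N :=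
          Nat.cast_le.2 (List.count_le_length.trans hlen)
        exact mul_le_mul_of_nonneg_left (mul_le_mul hcnt
          (pow_le_pow_of_le_one (norm_nonneg u) hu hl) (by positivity) (by positivity))
          (by positivity)
      calc ‖η‖ ≤ l * ‖u‖ + l * (N * ‖u‖ ^ 2) := (norm_add_le _ _).trans (add_le_add h1 h2)
        _ = _ := by ring
    refine ⟨q * (1 + η), ?_, ?_⟩
    · set A : ℝ := (L.sum : ℕ) * (‖u‖ + N * ‖u‖ ^ 2) with hA
      have h3 : ‖q * (1 + η) - 1‖ ≤ ‖q - 1‖ * (1 + ‖η‖) + ‖η‖ := by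
        rw [show q * (1 + η) - 1 = (q - 1) * (1 + η) + η by ring]
        refine (norm_add_le _ _).trans (add_le_add_left ?_ _)
        rw [norm_mul]
        gcongr
        exact (norm_add_le _ _).trans (by simp)
      have h4 : 1 + ‖η‖ ≤ Real.exp ‖η‖ := by
        rw [add_comm]
        exact Real.add_one_le_exp _
      calc _ ≤ (Real.exp A - 1) * (1 + ‖η‖) + ‖η‖ :=
            h3.trans (by gcongr)
        _ = Real.exp A * (1 + ‖η‖) - 1 := by ring
        _ ≤ Real.exp A * Real.exp (l * (‖u‖ + N * ‖u‖ ^ 2)) - 1 := by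
            gcongr
            exact h4.trans (Real.exp_le_exp.2 hηle)
        _ = _ := by
            rw [← Real.exp_add, hA, List.sum_cons]
            push_cast
            ring_nf
    · rw [List.cons_append, necklacePoly, List.sum_cons, eval_mul, eval_add, eval_C, ← mul_assoc,
        ← he, hη, pow_add]
      ring

end NecklaceAsymptotics

/-! ### The identity at a small complex point -/

section ClassExpansion

variable {n : ℕ}

/-- The centred number of ascents `(n - 1) / 2 - d(π)`. -/
noncomputable def centredAscents (π : Equiv.Perm (Fin n)) : ℝ :=
  ((n : ℝ) - 1) / 2 - descentNumber π

theorem abs_centredAscents_le (hn : 0 < n) (π : Equiv.Perm (Fin n)) :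
    |centredAscents π| ≤ n / 2 := by
  obtain ⟨m, rfl⟩ : ∃ m, n = m + 1 := ⟨n - 1, by omega⟩
  have h : (descentNumber π : ℝ) ≤ m := by exact_mod_cast descentNumber_le π
  have h0 : (0 : ℝ) ≤ descentNumber π := by positivity
  rw [centredAscents, abs_le]
  push_cast
  constructor <;> linarith

theorem numFixed_le (p : n.Partition) : numFixed p ≤ n := by
  have h : p.parts.card ≤ n := by
    have h1 := Multiset.card_nsmul_le_sum (s := p.parts) (a := 1) fun x hx => p.parts_pos hx
    simpa [p.parts_sum] using h1
  exact (Multiset.count_le_card _ _).trans h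

theorem exists_parts_eq_append (p : n.Partition) : ∃ L : List ℕ, (∀ l ∈ L, 2 ≤ l) ∧
    ((L ++ List.replicate (numFixed p) 1 : List ℕ) : Multiset ℕ) = p.parts := by
  refine ⟨(p.parts.filter (2 ≤ ·)).toList, fun l hl => ?_, ?_⟩
  · rw [Multiset.mem_toList] at hl
    exact (Multiset.mem_filter.1 hl).2
  · have h1 : p.parts.filter (fun i => ¬ 2 ≤ i) = Multiset.replicate (p.parts.count 1) 1 := by
      rw [← Multiset.filter_eq']
      refine Multiset.filter_congr fun x hx => ?_
      have := p.parts_pos hx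
      omega
    rw [← Multiset.coe_add, Multiset.coe_toList, Multiset.coe_replicate, numFixed, ← h1,
      Multiset.filter_add_not]

theorem exists_integral_prod_eq (p : n.Partition) {u : ℂ} (hu0 : u ≠ 0) (hu : ‖u‖ ≤ 1) :
    ∃ q : ℂ, ‖q - 1‖ ≤ Real.exp (n * (‖u‖ + n * ‖u‖ ^ 2)) - 1 ∧
      ∫ π, ∏ k ∈ Finset.range n, (1 + ((k : ℂ) - descentNumber π) * u) ∂(uniformClass p) =
        (∏ j ∈ Finset.range (numFixed p), (1 + (j : ℂ) * u)) * q := by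
  obtain ⟨L, hL, hparts⟩ := exists_parts_eq_append p
  set R := List.replicate (numFixed p) 1 with hR
  have hzu : u⁻¹ * u = 1 := inv_mul_cancel₀ hu0
  have hsum : (L ++ R).sum = n := by
    rw [← p.parts_sum, ← hparts, Multiset.sum_coe]
  have hlen : (L ++ R).length ≤ n := by
    have h1 := Multiset.card_nsmul_le_sum (s := p.parts) (a := 1) fun x hx => p.parts_pos hx
    rw [p.parts_sum, ← hparts, Multiset.coe_card] at h1
    simpa using h1
  obtain ⟨q, hq, he⟩ := exists_eval_necklacePoly_append hzu hu L R hL hlen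
  refine ⟨q, hq.trans ?_, ?_⟩
  · have : (L.sum : ℝ) ≤ n := by
      rw [Nat.cast_le, ← hsum, List.sum_append]
      omega
    gcongr
  · have h2 : R.sum = numFixed p := by simp [hR]
    rw [h2, hR, eval_necklacePoly_replicate_one hzu, ← hR, hsum,
      ← integral_prod_eq_eval_necklacePoly p _ hparts, ← integral_mul_const] at he
    rw [← he]
    congr 1
    funext π
    have hpow : u ^ n = ∏ _k ∈ Finset.range n, u := by simp
    rw [hpow, ← Finset.prod_mul_distrib]
    refine Finset.prod_congr rfl fun k _ => ?_
    rw [add_mul, hzu]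

/-- The second order expansion, at a small point `u`, of the generating identity. -/
theorem exists_integral_exp_eq (hn : 0 < n) (p : n.Partition) {u : ℂ} (hu0 : u ≠ 0)
    (hu : n * ‖u‖ ≤ 1 / 2) :
    ∃ (ε : Equiv.Perm (Fin n) → ℂ) (ε' q : ℂ), (∀ π, ‖ε π‖ ≤ n * (n * ‖u‖) ^ 3) ∧
      ‖ε'‖ ≤ n * (n * ‖u‖) ^ 3 ∧ ‖q - 1‖ ≤ Real.exp (n * ‖u‖ + (n * ‖u‖) ^ 2) - 1 ∧
      ∫ π, Complex.exp (u * (n * centredAscents π) - u ^ 2 / 2 *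
          (n * (centredAscents π : ℂ) ^ 2 + n * ((n : ℂ) ^ 2 - 1) / 12) + ε π) ∂(uniformClass p) =
        Complex.exp (u * (numFixed p * (numFixed p - 1) / 2) - u ^ 2 / 2 *
          (numFixed p * (numFixed p - 1) * (2 * numFixed p - 1) / 6) + ε') * q := by
  have hn1 : (1 : ℝ) ≤ n := by exact_mod_cast hn
  have hu1 : ‖u‖ ≤ 1 := by nlinarith [norm_nonneg u]
  obtain ⟨q, hq, he⟩ := exists_integral_prod_eq p hu0 hu1
  have hprod : ∀ π : Equiv.Perm (Fin n), ∃ ε : ℂ, ‖ε‖ ≤ n * (n * ‖u‖) ^ 3 ∧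
      ∏ k ∈ Finset.range n, (1 + ((k : ℂ) - descentNumber π) * u) =
        Complex.exp (u * (n * centredAscents π) - u ^ 2 / 2 *
          (n * (centredAscents π : ℂ) ^ 2 + n * ((n : ℂ) ^ 2 - 1) / 12) + ε) := by
    intro π
    have hle : ∀ k < n, ‖(k : ℂ) - descentNumber π‖ ≤ n := by
      intro k hk
      have hd : (descentNumber π : ℝ) ≤ n := by
        have : descentNumber π ≤ n := by
          simpa [descentNumber] using (descentSet π).card_le_univ
        exact_mod_cast this
      have hk' : (k : ℝ) ≤ n := by exact_mod_cast hk.le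
      have h0 : (0 : ℝ) ≤ descentNumber π := by positivity
      have h1 : (0 : ℝ) ≤ k := by positivity
      rw [show (k : ℂ) - descentNumber π = (((k : ℝ) - descentNumber π : ℝ) : ℂ) by push_cast; rfl,
        Complex.norm_real, Real.norm_eq_abs, abs_le]
      constructor <;> linarith
    obtain ⟨ε, hε, h⟩ := exists_prod_one_add_mul_eq_exp n
      (fun k => (k : ℂ) - descentNumber π) (B := n) (u := u) hle hu
    refine ⟨ε, hε, ?_⟩
    rw [h, sum_range_sub, sum_range_sub_sq, centredAscents]
    push_cast
    rfl
  choose ε hε hεprod using hprod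
  have hm : (numFixed p : ℝ) ≤ n := by exact_mod_cast numFixed_le p
  obtain ⟨ε', hε', h'⟩ := exists_prod_one_add_mul_eq_exp (numFixed p) (fun k => (k : ℂ)) (B := n)
    (u := u) (fun k hk => by
      rw [Complex.norm_natCast]
      exact le_trans (by exact_mod_cast hk.le) hm) hu
  refine ⟨ε, ε', q, hε, hε'.trans (by gcongr), hq.trans (le_of_eq (by ring_nf)), ?_⟩
  simp only [← hεprod]
  rw [he, h']
  have h1 := sum_range_sub (numFixed p) 0
  have h2 := sum_range_sub_sq (numFixed p) 0
  simp only [sub_zero] at h1 h2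
  rw [h1, h2]
  ring_nf

end ClassExpansion

/-! ### Imaginary scaling and error control -/

section Scaled

variable {n : ℕ}

/-- The expansion at the point `I * s / (n * b)`. -/
theorem exists_integral_exp_scaled (hn : 0 < n) (p : n.Partition) {b s κ : ℝ} (hb : 0 < b)
    (hs0 : s ≠ 0) (hsb : |s| / b ≤ 1 / 2) (hκ : κ = s ^ 2 * n / (2 * b ^ 2)) :
    ∃ (ε : Equiv.Perm (Fin n) → ℂ) (ε' q : ℂ), (∀ π, ‖ε π‖ ≤ n * (|s| / b) ^ 3) ∧
      ‖ε'‖ ≤ n * (|s| / b) ^ 3 ∧ ‖q - 1‖ ≤ Real.exp (|s| / b + (|s| / b) ^ 2) - 1 ∧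
      ∫ π, Complex.exp (Complex.I * ((s * centredAscents π / b : ℝ) : ℂ) +
          ((κ * ((centredAscents π / n) ^ 2 + 1 / 12) - κ / (12 * n ^ 2) : ℝ) : ℂ) + ε π)
            ∂(uniformClass p) =
        Complex.exp (Complex.I * ((s * (numFixed p * (numFixed p - 1)) / (2 * n * b) : ℝ) : ℂ) +
          ((κ * (((numFixed p : ℝ) / n) * ((numFixed p : ℝ) / n - 1 / n) *
            (2 * ((numFixed p : ℝ) / n) - 1 / n) / 6) : ℝ) : ℂ) + ε') * q := by
  have hn' : (n : ℝ) ≠ 0 := by positivity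
  have hnC : (n : ℂ) ≠ 0 := by exact_mod_cast hn.ne'
  have hbC : (b : ℂ) ≠ 0 := by exact_mod_cast hb.ne'
  have hI : (Complex.I : ℂ) ^ 2 = -1 := Complex.I_sq
  -- For imaginary `u` the linear term is a pure phase in `D`, and the quadratic one is real. The
  -- scale `b = n` serves the law of large numbers, `b = √n` the central limit theorem.
  set u : ℂ := Complex.I * ((s / (n * b) : ℝ) : ℂ) with hu
  have hu0 : u ≠ 0 := by
    refine mul_ne_zero Complex.I_ne_zero ?_
    rw [Complex.ofReal_ne_zero]
    positivity
  have hnorm : n * ‖u‖ = |s| / b := by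
    rw [hu, norm_mul, Complex.norm_I, one_mul, Complex.norm_real, Real.norm_eq_abs, abs_div,
      abs_of_pos (show (0 : ℝ) < n * b by positivity)]
    field_simp
  have hu2 : u ^ 2 = -((s / (n * b) : ℝ) : ℂ) ^ 2 := by
    rw [hu, mul_pow, hI]
    ring
  obtain ⟨ε, ε', q, h1, h2, h3, h4⟩ :=
    exists_integral_exp_eq hn p hu0 (by rw [hnorm]; exact hsb)
  rw [hnorm] at h1 h2 h3
  refine ⟨ε, ε', q, h1, h2, h3, ?_⟩
  convert h4 using 2
  · funext π
    congr 2
    rw [hu2, hu, hκ]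
    push_cast
    field_simp
    ring
  · congr 2
    rw [hu2, hu, hκ]
    push_cast
    field_simp
    ring

theorem integral_norm_exp_sub_one_le {Ω : Type*} [MeasurableSpace Ω] [Finite Ω]
    [DiscreteMeasurableSpace Ω] (μ : Measure Ω) [IsProbabilityMeasure μ] {X : Ω → ℂ} {g : Ω → ℝ}
    {M : ℝ} (hX : ∀ ω, ‖X ω‖ ≤ g ω) (hM : ∀ ω, g ω ≤ M) :
    ∫ ω, ‖Complex.exp (X ω) - 1‖ ∂μ ≤ Real.exp M * ∫ ω, g ω ∂μ := by
  rw [← integral_const_mul]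
  refine integral_mono .of_finite .of_finite fun ω => ?_
  have h := Complex.norm_exp_sub_sum_le_norm_mul_exp (X ω) 1
  simp only [Finset.range_one, Finset.sum_singleton, pow_zero, Nat.factorial_zero, Nat.cast_one,
    div_one, pow_one] at h
  refine h.trans ?_
  rw [mul_comm]
  have hle := Real.exp_le_exp.2 ((hX ω).trans (hM ω))
  exact mul_le_mul hle (hX ω) (norm_nonneg _) (Real.exp_pos M).le

/-- If `w` has modulus one, replacing `exp X` by `1` in an average costs at most the mean
of `‖exp X - 1‖`. -/
theorem norm_integral_mul_exp_sub_le {Ω : Type*} [MeasurableSpace Ω] [Finite Ω]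
    [DiscreteMeasurableSpace Ω] (μ : Measure Ω) [IsProbabilityMeasure μ] {w X : Ω → ℂ} {g : Ω → ℝ}
    {M : ℝ} (hw : ∀ ω, ‖w ω‖ = 1) (hX : ∀ ω, ‖X ω‖ ≤ g ω) (hM : ∀ ω, g ω ≤ M) :
    ‖∫ ω, w ω * Complex.exp (X ω) ∂μ - ∫ ω, w ω ∂μ‖ ≤ Real.exp M * ∫ ω, g ω ∂μ := by
  rw [← integral_sub .of_finite .of_finite]
  refine (norm_integral_le_integral_norm _).trans
    (le_trans (le_of_eq ?_) (integral_norm_exp_sub_one_le μ hX hM))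
  congr 1
  funext ω
  rw [← mul_sub_one, norm_mul, hw, one_mul]

end Scaled

/-! ### The characteristic function at scale `n` -/

section Limits

variable {n : ℕ → ℕ} {p : ∀ k, (n k).Partition} {α : ℝ}

theorem tendsto_expansion_rhs
    (hα : Tendsto (fun k => (numFixed (p k) : ℝ) / (n k : ℝ)) atTop (𝓝 α))
    (hn : Tendsto n atTop atTop) {κ : ℕ → ℝ} {κ₀ : ℝ} (hκ : Tendsto κ atTop (𝓝 κ₀)) :
    Tendsto (fun k => κ k * (((numFixed (p k) : ℝ) / n k) * ((numFixed (p k) : ℝ) / n k - 1 / n k) *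
      (2 * ((numFixed (p k) : ℝ) / n k) - 1 / n k) / 6)) atTop (𝓝 (κ₀ * (α ^ 3 / 3))) := by
  have h0 : Tendsto (fun k => 1 / (n k : ℝ)) atTop (𝓝 0) :=
    tendsto_one_div_atTop_nhds_zero_nat.comp hn
  have := hκ.mul (((hα.mul (hα.sub h0)).mul ((hα.const_mul 2).sub h0)).div_const 6)
  convert this using 2
  ring

theorem tendsto_of_norm_sub_one_le {q : ℕ → ℂ} {t : ℕ → ℝ} (ht : Tendsto t atTop (𝓝 0))
    (hq : ∀ᶠ k in atTop, ‖q k - 1‖ ≤ Real.exp (t k + t k ^ 2) - 1) :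
    Tendsto q atTop (𝓝 1) := by
  rw [tendsto_iff_norm_sub_tendsto_zero]
  refine squeeze_zero' (Eventually.of_forall fun _ => norm_nonneg _) hq ?_
  have : Tendsto (fun k => Real.exp (t k + t k ^ 2) - 1) atTop (𝓝 (Real.exp (0 + 0 ^ 2) - 1)) :=
    ((Real.continuous_exp.tendsto _).comp (ht.add (ht.pow 2))).sub_const 1
  simpa using this

/-- At this scale the quadratic coefficient is `1 / (2 n)`, so only the phases survive, and that of
the fixed points tends to `α² / 2`. The single frequency `1` will suffice, because `D/n` is confined
to `[-1/2, 1/2]`. -/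
theorem tendsto_integral_exp_centredAscents_div (hn : Tendsto n atTop atTop)
    (hα : Tendsto (fun k => (numFixed (p k) : ℝ) / (n k : ℝ)) atTop (𝓝 α)) :
    Tendsto (fun k => ∫ π, Complex.exp (Complex.I * ((centredAscents π / n k : ℝ) : ℂ))
      ∂(uniformClass (p k))) atTop (𝓝 (Complex.exp (Complex.I * ((α ^ 2 / 2 : ℝ) : ℂ)))) := by
  have hnR : Tendsto (fun k => (n k : ℝ)) atTop atTop := tendsto_natCast_atTop_atTop.comp hn
  have h0 : Tendsto (fun k => 1 / (n k : ℝ)) atTop (𝓝 0) :=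
    tendsto_one_div_atTop_nhds_zero_nat.comp hn
  have hex : ∀ k, ∃ (ε : Equiv.Perm (Fin (n k)) → ℂ) (ε' q : ℂ), 2 ≤ n k →
      ((∀ π, ‖ε π‖ ≤ n k * (|1| / (n k : ℝ)) ^ 3) ∧ ‖ε'‖ ≤ n k * (|1| / (n k : ℝ)) ^ 3 ∧
      ‖q - 1‖ ≤ Real.exp (|1| / (n k : ℝ) + (|1| / (n k : ℝ)) ^ 2) - 1 ∧
      ∫ π, Complex.exp (Complex.I * ((1 * centredAscents π / n k : ℝ) : ℂ) +
          ((1 / (2 * n k) * ((centredAscents π / n k) ^ 2 + 1 / 12) -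
            1 / (2 * n k) / (12 * n k ^ 2) : ℝ) : ℂ) + ε π) ∂(uniformClass (p k)) =
        Complex.exp (Complex.I *
          ((1 * (numFixed (p k) * (numFixed (p k) - 1)) / (2 * n k * n k) : ℝ) : ℂ) +
          ((1 / (2 * n k) * (((numFixed (p k) : ℝ) / n k) * ((numFixed (p k) : ℝ) / n k - 1 / n k) *
            (2 * ((numFixed (p k) : ℝ) / n k) - 1 / n k) / 6) : ℝ) : ℂ) + ε') * q) := by
    intro k
    by_cases hk : 2 ≤ n k
    · have hk' : (2 : ℝ) ≤ n k := by exact_mod_cast hk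
      obtain ⟨ε, ε', q, h⟩ := exists_integral_exp_scaled (b := n k) (s := 1)
        (κ := 1 / (2 * n k)) (by omega : 0 < n k) (p k) (by positivity) one_ne_zero
        (by rw [abs_one]; exact one_div_le_one_div_of_le two_pos hk') (by field_simp)
      exact ⟨ε, ε', q, fun _ => h⟩
    · exact ⟨0, 0, 0, fun h => absurd h hk⟩
  choose ε ε' q h using hex
  have hev : ∀ᶠ k in atTop, 2 ≤ n k := hn.eventually_ge_atTop 2
  have hε0 : Tendsto (fun k => (n k : ℝ) * (|1| / (n k : ℝ)) ^ 3) atTop (𝓝 0) := by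
    have := h0.pow 2
    simp only [ne_eq, OfNat.ofNat_ne_zero, not_false_eq_true, zero_pow] at this
    refine this.congr' (hev.mono fun k hk => ?_)
    have : (n k : ℝ) ≠ 0 := by
      rw [Nat.cast_ne_zero]
      omega
    rw [abs_one]
    field_simp
  have hε' : Tendsto ε' atTop (𝓝 0) :=
    squeeze_zero_norm' (hev.mono fun k hk => (h k hk).2.1) hε0
  have hq : Tendsto q atTop (𝓝 1) := tendsto_of_norm_sub_one_le (t := fun k => |1| / (n k : ℝ))
    (by simpa using h0) (hev.mono fun k hk => (h k hk).2.2.1)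
  have hκ : Tendsto (fun k => 1 / (2 * (n k : ℝ))) atTop (𝓝 0) := by
    have := h0.const_mul (1 / 2)
    rw [mul_zero] at this
    exact this.congr fun k => by ring
  have hrhs := tendsto_expansion_rhs hα hn hκ
  rw [zero_mul] at hrhs
  have hmain : Tendsto (fun k => (1 * (numFixed (p k) * ((numFixed (p k) : ℝ) - 1)) /
      (2 * n k * n k) : ℝ)) atTop (𝓝 (α ^ 2 / 2)) := by
    have := (hα.mul (hα.sub h0)).div_const 2
    rw [sub_zero] at this
    rw [sq]
    exact this.congr fun k => by ring
  have hR := ((Complex.continuous_exp.tendsto _).comp ((((Complex.continuous_ofReal.tendsto _).comp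
    hmain).const_mul Complex.I).add ((Complex.continuous_ofReal.tendsto _).comp hrhs)
      |>.add hε')).mul hq
  simp only [Complex.ofReal_zero, add_zero, mul_one] at hR
  refine (tendsto_of_tendsto_of_dist hR ?_)
  have hbound : Tendsto (fun k => Real.exp 2 * (1 / (2 * (n k : ℝ)) +
      (n k : ℝ) * (|1| / (n k : ℝ)) ^ 3)) atTop (𝓝 0) := by
    simpa using (hκ.add hε0).const_mul (Real.exp 2)
  refine squeeze_zero' (Eventually.of_forall fun _ => dist_nonneg) (hev.mono fun k hk => ?_) hbound
  have hn0 : (2 : ℝ) ≤ n k := by exact_mod_cast hk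
  have hκ0 : 0 ≤ 1 / (2 * (n k : ℝ)) := by positivity
  have hκ1 : 1 / (2 * (n k : ℝ)) ≤ 1 := by
    rw [div_le_one (by positivity)]
    linarith
  have he1 : (n k : ℝ) * (|1| / (n k : ℝ)) ^ 3 ≤ 1 := by
    rw [abs_one, show (n k : ℝ) * (1 / (n k : ℝ)) ^ 3 = 1 / (n k : ℝ) ^ 2 by field_simp,
      div_le_one (by positivity)]
    nlinarith
  have hb := norm_integral_mul_exp_sub_le (uniformClass (p k))
    (w := fun π => Complex.exp (Complex.I * ((centredAscents π / n k : ℝ) : ℂ)))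
    (X := fun π => ((1 / (2 * n k) * ((centredAscents π / n k) ^ 2 + 1 / 12) -
            1 / (2 * n k) / (12 * n k ^ 2) : ℝ) : ℂ) + ε k π)
    (g := fun _ => 1 / (2 * (n k : ℝ)) + (n k : ℝ) * (|1| / (n k : ℝ)) ^ 3) (M := 2)
    (fun π => by rw [mul_comm, Complex.norm_exp_ofReal_mul_I]) (fun π => ?_)
    (fun _ => by linarith)
  · rw [integral_const, probReal_univ, one_smul] at hb
    rw [dist_eq_norm]
    refine le_trans (le_of_eq ?_) hb
    simp only [Function.comp_apply]
    rw [← (h k hk).2.2.2]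
    congr 2
    congr 1
    funext π
    rw [← Complex.exp_add, one_mul, add_assoc]
  · refine (norm_add_le _ _).trans (add_le_add ?_ ((h k hk).1 π))
    rw [Complex.norm_real, Real.norm_eq_abs]
    have hG : (centredAscents π / n k) ^ 2 ≤ 1 / 4 := by
      have hD := abs_centredAscents_le (by omega) π
      rw [div_pow, div_le_iff₀ (by positivity), ← sq_abs]
      nlinarith [abs_nonneg (centredAscents π)]
    have hN : 1 / (12 * (n k : ℝ) ^ 2) ≤ 1 / 12 := by
      apply one_div_le_one_div_of_le (by norm_num)
      nlinarith
    have hN0 : 0 ≤ 1 / (12 * (n k : ℝ) ^ 2) := by positivity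
    rw [show 1 / (2 * (n k : ℝ)) * ((centredAscents π / n k) ^ 2 + 1 / 12) -
      1 / (2 * n k) / (12 * (n k : ℝ) ^ 2) = 1 / (2 * (n k : ℝ)) *
        ((centredAscents π / n k) ^ 2 + 1 / 12 - 1 / (12 * (n k : ℝ) ^ 2)) by ring, abs_mul,
      abs_of_nonneg hκ0]
    refine mul_le_of_le_one_right hκ0 (abs_le.2 ⟨?_, ?_⟩)
    · nlinarith [sq_nonneg (centredAscents π / n k)]
    · linarith

end Limits

/-! ### Law of large numbers and Gaussian limit -/

section CentralLimit

variable {n : ℕ → ℕ} {p : ∀ k, (n k).Partition} {α : ℝ}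

theorem limit_mem_Icc (hα : Tendsto (fun k => (numFixed (p k) : ℝ) / (n k : ℝ)) atTop (𝓝 α)) :
    α ∈ Set.Icc (0 : ℝ) 1 := by
  refine ⟨ge_of_tendsto' hα fun k => by positivity, le_of_tendsto' hα fun k => ?_⟩
  exact div_le_one_of_le₀ (by exact_mod_cast numFixed_le (p k)) (by positivity)

/-- With `x = D/n - α²/2`, the previous limit gives `E cos x → 1`. Since `|x| ≤ 1`, `x²` is at most
a constant times `1 - cos x`, and `|x| ≤ δ/2 + x²/(2δ)` turns this into convergence of `E |x|`. -/
theorem tendsto_integral_abs_centredAscents_div_sub (hn : Tendsto n atTop atTop)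
    (hα : Tendsto (fun k => (numFixed (p k) : ℝ) / (n k : ℝ)) atTop (𝓝 α)) :
    Tendsto (fun k => ∫ π, |centredAscents π / n k - α ^ 2 / 2| ∂(uniformClass (p k)))
      atTop (𝓝 0) := by
  obtain ⟨hα0, hα1⟩ := limit_mem_Icc hα
  set β := α ^ 2 / 2 with hβ
  have hβ0 : 0 ≤ β := by positivity
  have hβ1 : β ≤ 1 / 2 := by
    rw [hβ]
    nlinarith
  have hev : ∀ᶠ k in atTop, 0 < n k := hn.eventually_gt_atTop 0
  have hG : ∀ k, 0 < n k → ∀ π : Equiv.Perm (Fin (n k)),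
      |centredAscents π / n k - β| ≤ 1 := by
    intro k hk π
    have hD := abs_le.1 (abs_centredAscents_le hk π)
    have hk' : (0 : ℝ) < n k := by exact_mod_cast hk
    have h1 : centredAscents π / n k ≤ 1 / 2 := by
      rw [div_le_iff₀ hk']
      linarith
    have h2 : -(1 / 2) ≤ centredAscents π / n k := by
      rw [le_div_iff₀ hk']
      linarith
    rw [abs_le]
    constructor <;> linarith
  have hcos : Tendsto (fun k => ∫ π, Real.cos (centredAscents π / n k - β) ∂(uniformClass (p k)))
      atTop (𝓝 1) := by
    have h1 := (tendsto_integral_exp_centredAscents_div hn hα).mul_const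
      (Complex.exp (-(Complex.I * (β : ℂ))))
    rw [← Complex.exp_add, add_neg_cancel, Complex.exp_zero] at h1
    have h2 := (Complex.continuous_re.tendsto _).comp h1
    rw [Complex.one_re] at h2
    refine h2.congr fun k => ?_
    rw [Function.comp_apply, ← integral_mul_const]
    have h3 := integral_re (𝕜 := ℂ) (μ := uniformClass (p k)) (f := fun π =>
      Complex.exp (Complex.I * ((centredAscents π / n k : ℝ) : ℂ)) *
        Complex.exp (-(Complex.I * (β : ℂ)))) .of_finite
    refine Eq.trans h3.symm ?_
    congr 1
    funext π
    rw [← Complex.exp_add, show Complex.I * ((centredAscents π / n k : ℝ) : ℂ) +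
      -(Complex.I * (β : ℂ)) = ((centredAscents π / n k - β : ℝ) : ℂ) * Complex.I by
        push_cast; ring]
    exact Complex.exp_ofReal_mul_I_re _
  have hsq : ∀ δ : ℝ, 0 < δ → ∀ k, 0 < n k →
      ∫ π, |centredAscents π / n k - β| ∂(uniformClass (p k)) ≤ δ / 2 +
        Real.pi ^ 2 / (4 * δ) *
          (1 - ∫ π, Real.cos (centredAscents π / n k - β) ∂(uniformClass (p k))) := by
    intro δ hδ k hk
    have h1 : δ / 2 + Real.pi ^ 2 / (4 * δ) *
        (1 - ∫ π, Real.cos (centredAscents π / n k - β) ∂(uniformClass (p k))) =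
        ∫ π, (δ / 2 + Real.pi ^ 2 / (4 * δ) * (1 - Real.cos (centredAscents π / n k - β)))
          ∂(uniformClass (p k)) := by
      rw [integral_add .of_finite .of_finite, integral_const_mul,
        integral_sub .of_finite .of_finite]
      simp
    rw [h1]
    refine integral_mono .of_finite .of_finite fun π => ?_
    set x := centredAscents π / n k - β with hx
    have hx1 : |x| ≤ 1 := hG k hk π
    have hc := Real.cos_le_one_sub_mul_cos_sq (x := x) (hx1.trans (by linarith [Real.pi_gt_three]))
    have hpi : 0 < Real.pi := Real.pi_pos
    have h2 : x ^ 2 ≤ Real.pi ^ 2 / 2 * (1 - Real.cos x) := by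
      have : Real.pi ^ 2 / 2 * (2 / Real.pi ^ 2 * x ^ 2) = x ^ 2 := by field_simp
      rw [← this]
      gcongr
      linarith
    have h3 : |x| ≤ δ / 2 + x ^ 2 / (2 * δ) := by
      rw [← sub_nonneg, show δ / 2 + x ^ 2 / (2 * δ) - |x| = (δ - |x|) ^ 2 / (2 * δ) by
        rw [← sq_abs x]; field_simp; ring]
      positivity
    calc |x| ≤ δ / 2 + x ^ 2 / (2 * δ) := h3
      _ ≤ δ / 2 + (Real.pi ^ 2 / 2 * (1 - Real.cos x)) / (2 * δ) := by gcongr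
      _ = _ := by
        field_simp
        ring
  rw [Metric.tendsto_nhds]
  intro δ hδ
  have hlim : Tendsto (fun k => δ / 2 + Real.pi ^ 2 / (4 * δ) *
      (1 - ∫ π, Real.cos (centredAscents π / n k - β) ∂(uniformClass (p k)))) atTop
      (𝓝 (δ / 2 + Real.pi ^ 2 / (4 * δ) * (1 - 1))) :=
    ((hcos.const_sub 1).const_mul _).const_add _
  rw [sub_self, mul_zero, add_zero] at hlim
  filter_upwards [hlim.eventually_lt_const (half_lt_self hδ), hev] with k h1 h2
  rw [dist_zero_right, Real.norm_eq_abs, abs_of_nonneg (integral_nonneg fun _ => abs_nonneg _)]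
  exact (hsq δ hδ k h2).trans_lt h1

/-- The expansion at scale `√n` has the extra factor `exp(κ ((D/n)² + 1/12))`; by the `L¹` law of
large numbers it may be replaced by the constant `exp T` and divided out. -/
theorem tendsto_integral_exp_standardized (hn : Tendsto n atTop atTop)
    (hα : Tendsto (fun k => (numFixed (p k) : ℝ) / (n k : ℝ)) atTop (𝓝 α)) {s : ℝ} (hs : s ≠ 0) :
    Tendsto (fun k => ∫ π, Complex.exp (Complex.I * ((s * (centredAscents π / √(n k) -
      ((numFixed (p k) : ℝ) ^ 2 / (2 * n k * √(n k)) - 1 / √(n k))) : ℝ) : ℂ))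
        ∂(uniformClass (p k))) atTop
      (𝓝 (Complex.exp ((-(s ^ 2 / 2 * ((1 - 4 * α ^ 3 + 3 * α ^ 4) / 12)) : ℝ) : ℂ))) := by
  obtain ⟨hα0, hα1⟩ := limit_mem_Icc hα
  set κ := s ^ 2 / 2 with hκ
  have hκ0 : 0 ≤ κ := by positivity
  set β := α ^ 2 / 2 with hβ
  have hβ0 : 0 ≤ β := by positivity
  have hβ1 : β ≤ 1 / 2 := by
    rw [hβ]
    nlinarith
  set T : ℝ := κ * (β ^ 2 + 1 / 12) with hT
  set c : ℕ → ℝ := fun k => (numFixed (p k) : ℝ) ^ 2 / (2 * n k * √(n k)) - 1 / √(n k) with hc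
  have hnR : Tendsto (fun k => (n k : ℝ)) atTop atTop := tendsto_natCast_atTop_atTop.comp hn
  have h0 : Tendsto (fun k => 1 / (n k : ℝ)) atTop (𝓝 0) :=
    tendsto_one_div_atTop_nhds_zero_nat.comp hn
  have hr0 : Tendsto (fun k => 1 / √(n k : ℝ)) atTop (𝓝 0) := by
    simp only [one_div]
    exact tendsto_inv_atTop_zero.comp (Real.tendsto_sqrt_atTop.comp hnR)
  have ht0 : Tendsto (fun k => |s| / √(n k : ℝ)) atTop (𝓝 0) := by
    have := hr0.const_mul |s|
    rw [mul_zero] at this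
    exact this.congr fun k => by ring
  have hev : ∀ᶠ k in atTop, 0 < n k ∧ |s| / √(n k : ℝ) ≤ 1 / 2 :=
    (hn.eventually_gt_atTop 0).and (ht0.eventually_le_const (by norm_num))
  have hex : ∀ k, ∃ (ε : Equiv.Perm (Fin (n k)) → ℂ) (ε' q : ℂ),
      (0 < n k ∧ |s| / √(n k : ℝ) ≤ 1 / 2) →
      ((∀ π, ‖ε π‖ ≤ n k * (|s| / √(n k : ℝ)) ^ 3) ∧ ‖ε'‖ ≤ n k * (|s| / √(n k : ℝ)) ^ 3 ∧
      ‖q - 1‖ ≤ Real.exp (|s| / √(n k : ℝ) + (|s| / √(n k : ℝ)) ^ 2) - 1 ∧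
      ∫ π, Complex.exp (Complex.I * ((s * centredAscents π / √(n k : ℝ) : ℝ) : ℂ) +
          ((κ * ((centredAscents π / n k) ^ 2 + 1 / 12) - κ / (12 * n k ^ 2) : ℝ) : ℂ) + ε π)
            ∂(uniformClass (p k)) =
        Complex.exp (Complex.I *
          ((s * (numFixed (p k) * (numFixed (p k) - 1)) / (2 * n k * √(n k : ℝ)) : ℝ) : ℂ) +
          ((κ * (((numFixed (p k) : ℝ) / n k) * ((numFixed (p k) : ℝ) / n k - 1 / n k) *
            (2 * ((numFixed (p k) : ℝ) / n k) - 1 / n k) / 6) : ℝ) : ℂ) + ε') * q) := by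
    intro k
    by_cases hk : 0 < n k ∧ |s| / √(n k : ℝ) ≤ 1 / 2
    · have hk' : (0 : ℝ) < n k := by exact_mod_cast hk.1
      obtain ⟨ε, ε', q, h⟩ := exists_integral_exp_scaled (b := √(n k : ℝ)) (s := s)
        (κ := κ) hk.1 (p k) (by positivity) hs hk.2 (by
          rw [Real.sq_sqrt hk'.le, hκ]
          field_simp)
      exact ⟨ε, ε', q, fun _ => h⟩
    · exact ⟨0, 0, 0, fun h => absurd h hk⟩
  choose ε ε' q h using hex
  have hε0 : Tendsto (fun k => (n k : ℝ) * (|s| / √(n k : ℝ)) ^ 3) atTop (𝓝 0) := by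
    have := hr0.const_mul (|s| ^ 3)
    rw [mul_zero] at this
    refine this.congr' (hev.mono fun k hk => ?_)
    have hk' : (0 : ℝ) < n k := by exact_mod_cast hk.1
    have h1 : √(n k : ℝ) ≠ 0 := by positivity
    have h2 : (n k : ℝ) = √(n k : ℝ) ^ 2 := (Real.sq_sqrt hk'.le).symm
    change _ = (n k : ℝ) * (|s| / √(n k : ℝ)) ^ 3
    rw [show (n k : ℝ) * (|s| / √(n k : ℝ)) ^ 3 =
      √(n k : ℝ) ^ 2 * (|s| / √(n k : ℝ)) ^ 3 by rw [← h2]]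
    field_simp
  have hε' : Tendsto ε' atTop (𝓝 0) :=
    squeeze_zero_norm' (hev.mono fun k hk => (h k hk).2.1) hε0
  have hq : Tendsto q atTop (𝓝 1) :=
    tendsto_of_norm_sub_one_le ht0 (hev.mono fun k hk => (h k hk).2.2.1)
  have hrhs := tendsto_expansion_rhs hα hn (tendsto_const_nhds (x := κ))
  -- The difference equals `(s / √n) (1 - m₁ / (2 n))`, so the exact phase and the centring `s * c
  -- k` agree in the limit.
  have hmain : Tendsto (fun k => (s * (numFixed (p k) * ((numFixed (p k) : ℝ) - 1)) /
      (2 * n k * √(n k : ℝ)) - s * c k : ℝ)) atTop (𝓝 0) := by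
    have := (hr0.mul ((hα.div_const 2).const_sub 1)).const_mul s
    rw [zero_mul, mul_zero] at this
    refine this.congr' (hev.mono fun k hk => ?_)
    have hk' : (0 : ℝ) < n k := by exact_mod_cast hk.1
    have h1 : √(n k : ℝ) ≠ 0 := by positivity
    rw [hc]
    field_simp
    ring
  have hR := (((Complex.continuous_exp.tendsto _).comp ((((Complex.continuous_ofReal.tendsto _).comp
    hmain).const_mul Complex.I).add ((Complex.continuous_ofReal.tendsto _).comp hrhs)
      |>.add hε')).mul hq).mul_const (Complex.exp (-(T : ℂ)))
  have hval : Complex.exp (Complex.I * ((0 : ℝ) : ℂ) + ((κ * (α ^ 3 / 3) : ℝ) : ℂ) + 0) * 1 *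
      Complex.exp (-(T : ℂ)) =
      Complex.exp ((-(κ * ((1 - 4 * α ^ 3 + 3 * α ^ 4) / 12)) : ℝ) : ℂ) := by
    rw [mul_one, ← Complex.exp_add]
    congr 1
    rw [hT, hβ]
    push_cast
    ring
  rw [hval] at hR
  refine tendsto_of_tendsto_of_dist hR ?_
  have hL1 := tendsto_integral_abs_centredAscents_div_sub hn hα
  have hη : Tendsto (fun k => κ / (12 * (n k : ℝ) ^ 2) + (n k : ℝ) * (|s| / √(n k : ℝ)) ^ 3)
      atTop (𝓝 0) := by
    have h1 := ((h0.pow 2).const_mul (κ / 12)).add hε0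
    simp only [ne_eq, OfNat.ofNat_ne_zero, not_false_eq_true, zero_pow, mul_zero, add_zero] at h1
    exact h1.congr fun k => by ring
  have hbound : Tendsto (fun k => Real.exp (κ + 1) *
      (κ * ∫ π, |centredAscents π / n k - β| ∂(uniformClass (p k)) +
        (κ / (12 * (n k : ℝ) ^ 2) + (n k : ℝ) * (|s| / √(n k : ℝ)) ^ 3))) atTop (𝓝 0) := by
    simpa using ((hL1.const_mul κ).add hη).const_mul (Real.exp (κ + 1))
  refine squeeze_zero' (Eventually.of_forall fun _ => dist_nonneg) ?_ hbound
  filter_upwards [hev, hη.eventually_le_const (show (0 : ℝ) < 1 by norm_num)] with k hk hk1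
  have hk' : (0 : ℝ) < n k := by exact_mod_cast hk.1
  have hG : ∀ π : Equiv.Perm (Fin (n k)), |centredAscents π / n k| ≤ 1 / 2 := by
    intro π
    have hD := abs_centredAscents_le hk.1 π
    rw [abs_div, abs_of_pos hk', div_le_iff₀ hk']
    linarith
  -- After division by `exp T` the random error is `κ ((D/n)² - β²)`, at most `κ |D/n - β|` because
  -- `|D/n + β| ≤ 1`. The other errors are deterministically small, and the total is at most `κ +
  -- 1`.
  have hb := norm_integral_mul_exp_sub_le (uniformClass (p k))
    (w := fun π => Complex.exp (Complex.I *
      ((s * (centredAscents π / √(n k) - c k) : ℝ) : ℂ)))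
    (X := fun π => ((κ * ((centredAscents π / n k) ^ 2 - β ^ 2) - κ / (12 * n k ^ 2) : ℝ) : ℂ) +
      ε k π)
    (g := fun π => κ * |centredAscents π / n k - β| +
      (κ / (12 * (n k : ℝ) ^ 2) + (n k : ℝ) * (|s| / √(n k : ℝ)) ^ 3)) (M := κ + 1)
    (fun π => by rw [mul_comm, Complex.norm_exp_ofReal_mul_I]) (fun π => ?_)
    (fun π => ?_)
  · rw [integral_add .of_finite .of_finite, integral_const_mul, integral_const, probReal_univ,
      one_smul] at hb
    rw [dist_eq_norm]
    refine le_trans (le_of_eq ?_) hb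
    simp only [Function.comp_apply]
    congr 2
    have hsplit : Complex.exp (Complex.I * ((s * (numFixed (p k) * ((numFixed (p k) : ℝ) - 1)) /
        (2 * n k * √(n k : ℝ)) - s * c k : ℝ) : ℂ) +
          ((κ * (((numFixed (p k) : ℝ) / n k) * ((numFixed (p k) : ℝ) / n k - 1 / n k) *
            (2 * ((numFixed (p k) : ℝ) / n k) - 1 / n k) / 6) : ℝ) : ℂ) + ε' k) * q k *
          Complex.exp (-(T : ℂ)) =
        (Complex.exp (Complex.I *
          ((s * (numFixed (p k) * (numFixed (p k) - 1)) / (2 * n k * √(n k : ℝ)) : ℝ) : ℂ) +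
          ((κ * (((numFixed (p k) : ℝ) / n k) * ((numFixed (p k) : ℝ) / n k - 1 / n k) *
            (2 * ((numFixed (p k) : ℝ) / n k) - 1 / n k) / 6) : ℝ) : ℂ) + ε' k) * q k) *
          Complex.exp (-(Complex.I * ((s * c k : ℝ) : ℂ)) - T) := by
      rw [mul_right_comm, mul_right_comm _ (q k), ← Complex.exp_add, ← Complex.exp_add]
      congr 2
      rw [Complex.ofReal_sub]
      ring
    rw [hsplit, ← (h k hk).2.2.2, ← integral_mul_const]
    congr 1
    funext π
    rw [← Complex.exp_add, ← Complex.exp_add]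
    congr 1
    rw [hT]
    push_cast
    ring
  · rw [← add_assoc]
    refine (norm_add_le _ _).trans (add_le_add ?_ ((h k hk).1 π))
    rw [Complex.norm_real, Real.norm_eq_abs]
    refine (abs_sub _ _).trans (add_le_add ?_ (le_of_eq (abs_of_nonneg (by positivity))))
    rw [abs_mul, abs_of_nonneg hκ0, sq_sub_sq, abs_mul]
    refine mul_le_mul_of_nonneg_left (mul_le_of_le_one_left (abs_nonneg _) ?_) hκ0
    have := abs_le.1 (hG π)
    rw [abs_le]
    constructor <;> linarith
  · refine add_le_add (mul_le_of_le_one_right hκ0 ?_) hk1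
    have := abs_le.1 (hG π)
    rw [abs_le]
    constructor <;> linarith

end CentralLimit

/-- Along any sequence of partitions `p k` of `n k` with `n k → ∞` and `m₁ / n → α`, the
normalized descent numbers of uniform elements of the conjugacy classes converge in distribution to
the centred normal law of variance `(1 - 4 α ^ 3 + 3 α ^ 4) / 12`. This number equals
`(1 - α) ^ 2 * (1 + 2 α + 3 α ^ 2) / 12 ≥ 0`, so `Real.toNNReal` does not truncate it; for `α = 1`
the limit law is the Dirac mass at `0`. -/
theorem theorem1p3 (n : ℕ → ℕ) (p : ∀ k, (n k).Partition) (α : ℝ)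
    (hn : Filter.Tendsto n Filter.atTop Filter.atTop)
    (hα : Filter.Tendsto (fun k => (numFixed (p k) : ℝ) / (n k : ℝ)) Filter.atTop (nhds α)) :
    MeasureTheory.TendstoInDistribution
      (fun k => normDescents (p k)) Filter.atTop (id : ℝ → ℝ)
      (fun k => uniformClass (p k))
      (ProbabilityTheory.gaussianReal 0
        (Real.toNNReal ((1 - 4 * α ^ 3 + 3 * α ^ 4) / 12))) := by
  have hmeas : ∀ k, AEMeasurable (normDescents (p k)) (uniformClass (p k)) :=
    fun k => Measurable.of_discrete.aemeasurable
  refine ⟨hmeas, aemeasurable_id, ?_⟩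
  refine ProbabilityMeasure.tendsto_iff_tendsto_charFun.2 fun t => ?_
  simp only [ProbabilityMeasure.coe_mk]
  rw [Measure.map_id, ProbabilityTheory.charFun_gaussianReal]
  have hcf : ∀ k, charFun ((uniformClass (p k)).map (normDescents (p k))) t =
      ∫ π, Complex.exp (t * normDescents (p k) π * Complex.I) ∂(uniformClass (p k)) := by
    intro k
    rw [charFun_apply_real, integral_map (hmeas k) (by fun_prop)]
  simp only [hcf]
  have hvar : 0 ≤ (1 - 4 * α ^ 3 + 3 * α ^ 4) / 12 := by
    rw [show (1 - 4 * α ^ 3 + 3 * α ^ 4) / 12 = (1 - α) ^ 2 * (2 * α ^ 2 + (1 + α) ^ 2) / 12 by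
      ring]
    positivity
  -- The expansion point must be nonzero, so `t = 0` is separate. For `t ≠ 0` the frequency is `-t`,
  -- since ascents and descents have opposite signs: `D - m₁²/(2n) + 1 = -√n W`.
  rcases eq_or_ne t 0 with rfl | ht
  · simp
  · refine ((tendsto_integral_exp_standardized hn hα (neg_ne_zero.2 ht)).congr' ?_).trans
      (le_of_eq ?_)
    · filter_upwards [hn.eventually_gt_atTop 0] with k hk
      congr 1
      funext π
      congr 1
      have hk' : (0 : ℝ) < n k := by exact_mod_cast hk
      have h1 : √(n k : ℝ) ≠ 0 := by positivity
      rw [show -t * (centredAscents π / √(n k) -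
        ((numFixed (p k) : ℝ) ^ 2 / (2 * n k * √(n k)) - 1 / √(n k))) =
          t * normDescents (p k) π by
            rw [centredAscents, normDescents]
            field_simp
            ring]
      push_cast
      ring
    · congr 2
      rw [Complex.ofReal_neg, Complex.ofReal_mul, show
        ((((Real.toNNReal ((1 - 4 * α ^ 3 + 3 * α ^ 4) / 12) : NNReal) : ℝ)) : ℂ) =
          (((1 - 4 * α ^ 3 + 3 * α ^ 4) / 12 : ℝ) : ℂ) by rw [Real.coe_toNNReal _ hvar]]
      push_cast
      ring
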